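/- Let $d\ge 3$ and let $\phi=(\phi_x)_{x\in\mathbb Z^d}$ be the Gaussian free field on $\mathbb Z^d$, i.e. the centered Gaussian field with covariance $\mathbb E[\phi_x\phi_y]=g(x,y)$, where $g(x,y)=\sum_{n\ge 0}P_x[X_n=y]$ is the Green function of simple random walk on $\mathbb Z^d$. For $h\in\mathbb R$ and $A,B\subseteq\mathbb Z^d$, let $\{A\xleftrightarrow{\ge h}B\}$ be the event that some nearest-neighbour path contained in $\{x\in\mathbb Z^d:\phi_x\ge h\}$ connects a point of $A$ to a point of $B$; for single points write $\{x\xleftrightarrow{\ge h}y\}$. Let $B(0,L)$ and $S(0,L)$ be the $\ell^\infty$-ball and $\ell^\infty$-sphere of radius $L$ around $0$ in $\mathbb Z^d$, and let $\partial K$ be the set of points of $K\subseteq\mathbb Z^d$ with a nearest neighbour outside $K$. Let $\|\cdot\|$ be the Euclidean norm. Boxes $[a,b]^d$ are understood as subsets of $\mathbb Z^d$, and $L$ runs over the positive integers. Define $$h_{**}=h_{**}(d)=\inf\Big\{h\in\mathbb R:\ \text{for some }\alpha>0,\ \lim_{L\to\infty}L^{\alpha}\,\mathbb P\big[B(0,L)\xleftrightarrow{\ge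 h}S(0,2L)\big]=0\Big\}.$$ 1. If $d\ge 4$ and $h>h_{**}(d)$, then there are constants $\gamma_1=\gamma_1(d,h)>0$ and $\gamma_2=\gamma_2(d,h)>0$ such that $$\mathbb P[0\xleftrightarrow{\ge h}x]\le\gamma_1\exp\{-\gamma_2\|x\|\}\qquad\text{for every }x\in\mathbb Z^d.$$ 2. If $d=3$ and $h>h_{**}(3)$, then for every $b>1$ there are constants $\gamma_1'=\gamma_1'(h,b)>0$ and $\gamma_2'=\gamma_2'(h,b)>0$ such that $$\mathbb P[0\xleftrightarrow{\ge h}x]\le\gamma_1'\exp\Big\{-\gamma_2'\frac{\|x\|}{\log^{3b}\|x\|}\Big\}\qquad\text{for every }x\in\mathbb Z^3\text{ with }\|x\|>1.$$ 3. For every $d\ge 3$, $$h_{**}=\inf\Big\{h>0:\ \liminf_{L\to\infty}\mathbb P\big[[0,L]^d\xleftrightarrow{\ge h}\partial[-L,2L]^d\big]<\frac{7}{2d\cdot 21^d}\Big\}.$$ -/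

import Mathlib

open MeasureTheory ProbabilityTheory Filter Topology

noncomputable section

namespace GFF

/-- The nearest-neighbour graph on `ℤ^d`: two sites are adjacent when their `ℓ¹` distance is 1. -/
def lattice (d : ℕ) : SimpleGraph (Fin d → ℤ) where
  Adj x y := ∑ i, |x i - y i| = 1
  symm := ⟨fun x y h => by simpa only [abs_sub_comm] using h⟩
  loopless := ⟨fun x h => by simp at h⟩

/-- The probability `P_x[X_n = y]` for simple random walk on `ℤ^d`: the walk jumps from `x` to
each of the `2d` neighbours `x ± e_i` with probability `1 / (2d)`. -/
def stepProb (d : ℕ) : ℕ → (Fin d → ℤ) → (Fin d → ℤ) → ℝ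
  | 0, x, y => if x = y then 1 else 0
  | n + 1, x, y =>
      (∑ i, (stepProb d n (x + Pi.single i 1) y + stepProb d n (x - Pi.single i 1) y)) / (2 * d)

/-- The Green function `g(x, y) = ∑_{n ≥ 0} P_x[X_n = y]` of simple random walk on `ℤ^d`
(the series converges when `d ≥ 3`). -/
def green (d : ℕ) (x y : Fin d → ℤ) : ℝ :=
  ∑' n, stepProb d n x y

/-- `μ` is the law on `ℝ^{ℤ^d}` of the Gaussian free field: under `μ`, the coordinates form a
centered Gaussian field with covariance `g`. These properties determine all finite-dimensional
marginals, so there is only one such law for each `d`. -/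
structure IsGFF {d : ℕ} (μ : Measure ((Fin d → ℤ) → ℝ)) : Prop where
  gaussian : IsGaussianProcess (fun (x : Fin d → ℤ) (φ : (Fin d → ℤ) → ℝ) => φ x) μ
  centered : ∀ x : Fin d → ℤ, ∫ φ, φ x ∂μ = 0
  covariance : ∀ x y : Fin d → ℤ, ∫ φ, φ x * φ y ∂μ = green d x y

/-- The excursion set of the configuration `φ` above level `h`. -/
def excursionSet {d : ℕ} (h : ℝ) (φ : (Fin d → ℤ) → ℝ) : Set (Fin d → ℤ) :=
  {x | h ≤ φ x}

/-- The event that some nearest-neighbour path inside the excursion set above level `h`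
connects a point of `A` to a point of `B`. -/
def connects {d : ℕ} (h : ℝ) (A B : Set (Fin d → ℤ)) : Set ((Fin d → ℤ) → ℝ) :=
  {φ | ∃ x ∈ A, ∃ y ∈ B, ∃ w : (lattice d).Walk x y, ∀ z ∈ w.support, z ∈ excursionSet h φ}

/-- The inner boundary of `K ⊆ ℤ^d`: points of `K` with a neighbour outside `K`. -/
def innerBoundary {d : ℕ} (K : Set (Fin d → ℤ)) : Set (Fin d → ℤ) :=
  {x | x ∈ K ∧ ∃ y, y ∉ K ∧ (lattice d).Adj x y}

/-- The box `[a, b]^d` in `ℤ^d`. -/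
def box (d : ℕ) (a b : ℤ) : Set (Fin d → ℤ) :=
  {x | ∀ i, a ≤ x i ∧ x i ≤ b}

/-- The `ℓ^∞` ball of radius `L` around the origin. -/
def supBall (d L : ℕ) : Set (Fin d → ℤ) :=
  {x | ∀ i, |x i| ≤ L}

/-- The `ℓ^∞` sphere of radius `L` around the origin (for `d ≥ 1`). -/
def supSphere (d L : ℕ) : Set (Fin d → ℤ) :=
  {x | (∀ i, |x i| ≤ L) ∧ ∃ i, |x i| = L}

/-- The critical level `h_**`: the infimum, in `[-∞, ∞]`, of the levels `h` at which the
probability of crossing from `B(0, L)` to `S(0, 2L)` decays at least polynomially in `L`. -/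
def hStarStar {d : ℕ} (μ : Measure ((Fin d → ℤ) → ℝ)) : EReal :=
  sInf (Real.toEReal '' {h : ℝ | ∃ α : ℝ, 0 < α ∧
    Tendsto (fun L : ℕ => (L : ℝ) ^ α * μ.real (connects h (supBall d L) (supSphere d (2 * L))))
      atTop (𝓝 0)})

/-- The Euclidean norm of a point of `ℤ^d`. -/
def euclNorm {d : ℕ} (x : Fin d → ℤ) : ℝ :=
  ‖(WithLp.toLp 2 (fun i => (x i : ℝ)) : EuclideanSpace ℝ (Fin d))‖

end GFF

end

/-! The engine is a recursion over scales for the probability `p` of crossing from a box to the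
boundary of the concentric box of triple width. A crossing at scale `2L + 2s` forces crossings in
two boxes of scale `L` whose domains are at distance at least `s`, taken from `pairCount d = 2d *
21^d / 7` possible pairs (`exists_pair_crossing`). By the domain Markov property, the field is its
harmonic average from one domain plus a remainder independent of the field there. On the other
domain this average is Gaussian with variance at most the Green function at distance `s`, so a small
rise of the level makes the two crossings independent up to a Gaussian tail (`IsGFF.decoupling`). Up
to this error the next `p` is at most `pairCount d * p ^ 2`, which contracts once `pairCount d * p <
1`: this is the threshold of part 3.

Along the scales `2^k`, up to constants, both the level increments and the relative gaps are of
order `(k+1)^(-b)`. Since `b > 1` they are summable, so the levels stay below any prescribed `h' >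
h` (`IsGFF.renormalization`). The rate is limited by the decoupling exponent, increment squared
times gap to the power `decayExp d`. With power 2 (`d ≥ 4`) it outgrows `2^k` and the decay is
exponential; with power 1 (`d = 3`) it is `2^k (k+1)^(-3b)`, whence `log^(3b)`. The bound on the
Green function comes from the explicit superharmonic functions `1/(|x|²+2)` and, for `d = 3`, its
square root.

Part 3 only admits positive levels, so it also needs `h_** ≥ 0`. At a negative level `h`, reveal the
cluster of the boundary of a large box. If it misses the origin, the conditional mean of the field
there is at most `h`; the total mean being zero, the cluster reaches the origin with probability
bounded below (`IsGFF.le_measureReal_cluster`). -/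

noncomputable section

namespace GFF


/-! ### Superharmonic functions and decay of the Green function -/

/-- The average of `u` over the `2d` neighbours of `x`. -/
def avg {d : ℕ} (u : (Fin d → ℤ) → ℝ) (x : Fin d → ℤ) : ℝ :=
  (∑ i, (u (x + Pi.single i 1) + u (x - Pi.single i 1))) / (2 * d)

theorem avg_mono {d : ℕ} {u v : (Fin d → ℤ) → ℝ} {x : Fin d → ℤ}
    (h : ∀ i, u (x + Pi.single i 1) ≤ v (x + Pi.single i 1) ∧
      u (x - Pi.single i 1) ≤ v (x - Pi.single i 1)) : avg u x ≤ avg v x := by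
  unfold avg
  gcongr with i
  · exact (h i).1
  · exact (h i).2

theorem avg_congr {d : ℕ} {u v : (Fin d → ℤ) → ℝ} {x : Fin d → ℤ}
    (h : ∀ i, u (x + Pi.single i 1) = v (x + Pi.single i 1) ∧
      u (x - Pi.single i 1) = v (x - Pi.single i 1)) : avg u x = avg v x :=
  le_antisymm (avg_mono fun i => ⟨(h i).1.le, (h i).2.le⟩)
    (avg_mono fun i => ⟨(h i).1.ge, (h i).2.ge⟩)

theorem avg_const {d : ℕ} (hd : d ≠ 0) (c : ℝ) (x : Fin d → ℤ) : avg (fun _ => c) x = c := by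
  have : (d : ℝ) ≠ 0 := by exact_mod_cast hd
  simp [avg]
  field_simp
  ring

theorem avg_sum {d : ℕ} {ι : Type*} (s : Finset ι) (u : ι → (Fin d → ℤ) → ℝ) (x : Fin d → ℤ) :
    avg (fun z => ∑ j ∈ s, u j z) x = ∑ j ∈ s, avg (u j) x := by
  simp only [avg, ← Finset.sum_div, ← Finset.sum_add_distrib]
  rw [Finset.sum_comm]

theorem avg_mul_right {d : ℕ} (u : (Fin d → ℤ) → ℝ) (c : ℝ) (x : Fin d → ℤ) :
    avg (fun z => u z * c) x = avg u x * c := by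
  simp only [avg, ← add_mul, ← Finset.sum_mul]
  ring

theorem avg_sub {d : ℕ} (u v : (Fin d → ℤ) → ℝ) (x : Fin d → ℤ) :
    avg (fun z => u z - v z) x = avg u x - avg v x := by
  simp only [avg, ← sub_div, ← Finset.sum_sub_distrib]
  congr 1
  exact Finset.sum_congr rfl fun i _ => by ring

theorem avg_nonneg {d : ℕ} {u : (Fin d → ℤ) → ℝ} {x : Fin d → ℤ} (h : ∀ z, 0 ≤ u z) :
    0 ≤ avg u x :=
  div_nonneg (Finset.sum_nonneg fun i _ => add_nonneg (h _) (h _)) (by positivity)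

theorem stepProb_succ {d : ℕ} (n : ℕ) (x y : Fin d → ℤ) :
    stepProb d (n + 1) x y = avg (fun z => stepProb d n z y) x := rfl

theorem stepProb_nonneg {d : ℕ} (n : ℕ) (x y : Fin d → ℤ) : 0 ≤ stepProb d n x y := by
  induction n generalizing x with
  | zero => simp only [stepProb]; split_ifs <;> norm_num
  | succ n ih => exact avg_nonneg fun z => ih z

/-- A nonnegative superharmonic function, strictly so at the origin, dominates the Green
function. -/
theorem sum_stepProb_le {d : ℕ} {f : (Fin d → ℤ) → ℝ} (hf : ∀ x, 0 ≤ f x)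
    (hsup : ∀ x, avg f x ≤ f x) (x y : Fin d → ℤ) (N : ℕ) :
    (f 0 - avg f 0) * ∑ n ∈ Finset.range N, stepProb d n x y ≤ f (x - y) := by
  -- The partial sums obey `G_{N+1} = 1_{x = y} + avg G_N`. Off the diagonal, superharmonicity
  -- closes the induction; at `x = y` the defect `f 0 - avg f 0` pays exactly for the extra term.
  induction N generalizing x with
  | zero => simpa using hf _
  | succ N ih =>
    rw [Finset.sum_range_succ']
    simp only [stepProb_succ]
    rw [← avg_sum]
    have h1 : (f 0 - avg f 0) * avg (fun z => ∑ n ∈ Finset.range N, stepProb d n z y) x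
        ≤ avg f (x - y) := by
      rw [mul_comm, ← avg_mul_right]
      have : avg f (x - y) = avg (fun z => f (z - y)) x := by
        simp only [avg]
        simp only [sub_add_eq_add_sub, sub_right_comm]
      rw [this]
      exact avg_mono fun i => ⟨by rw [mul_comm]; exact ih _, by rw [mul_comm]; exact ih _⟩
    rw [mul_add]
    by_cases hxy : x = y
    · subst hxy
      simp only [stepProb, if_true, sub_self] at h1 ⊢
      linarith
    · simp only [stepProb, if_neg hxy]
      linarith [hsup (x - y)]

/-- The squared Euclidean norm, plus two. -/
def normSqTwo {d : ℕ} (x : Fin d → ℤ) : ℝ := ∑ i, (x i : ℝ) ^ 2 + 2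

theorem two_le_normSqTwo {d : ℕ} (x : Fin d → ℤ) : 2 ≤ normSqTwo x := by
  have : 0 ≤ ∑ i, (x i : ℝ) ^ 2 := Finset.sum_nonneg fun i _ => sq_nonneg _
  unfold normSqTwo; linarith

theorem normSqTwo_add_single {d : ℕ} (x : Fin d → ℤ) (i : Fin d) (c : ℤ) :
    normSqTwo (x + Pi.single i c) = normSqTwo x + 2 * c * x i + c ^ 2 := by
  have h : ∀ j, ((x + Pi.single i c : Fin d → ℤ) j : ℝ) ^ 2 =
      (x j : ℝ) ^ 2 + if j = i then (2 * c * x i + c ^ 2 : ℝ) else 0 := by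
    intro j
    by_cases hj : j = i
    · subst hj; simp; ring
    · simp [hj]
  simp only [normSqTwo, h, Finset.sum_add_distrib]
  simp
  ring

theorem sq_le_normSqTwo {d : ℕ} (x : Fin d → ℤ) (i : Fin d) :
    (x i : ℝ) ^ 2 ≤ normSqTwo x - 2 := by
  unfold normSqTwo
  have := Finset.single_le_sum (f := fun i => (x i : ℝ) ^ 2) (fun i _ => sq_nonneg _)
    (Finset.mem_univ i)
  linarith

theorem denom_pos {u t : ℝ} (ht : t ^ 2 ≤ u - 2) :
    0 < u + 1 + 2 * t ∧ 0 < u + 1 - 2 * t := by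
  constructor <;> nlinarith [sq_nonneg (t - 1), sq_nonneg (t + 1)]

/-- The neighbours in direction `i` have `normSqTwo` equal to `u + 1 ± 2 x_i`, and this sum is half
the sum of their reciprocals. Each term is bounded by an affine function of `x_i ^ 2`, and these
squares add up to `u - 2`. -/
theorem sum_denom_le {d : ℕ} (x : Fin d → ℤ) :
    ∑ i, (normSqTwo x + 1) / ((normSqTwo x + 1) ^ 2 - 4 * (x i : ℝ) ^ 2) ≤
      d / (normSqTwo x + 1) + 4 / ((normSqTwo x + 1) * normSqTwo x) := by
  set u := normSqTwo x with hu
  have hu2 : 2 ≤ u := two_le_normSqTwo x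
  have hm : 0 < u ^ 2 - 2 * u + 9 := by nlinarith
  have h : ∀ i, (u + 1) / ((u + 1) ^ 2 - 4 * (x i : ℝ) ^ 2) ≤
      1 / (u + 1) + 4 / ((u + 1) * (u ^ 2 - 2 * u + 9)) * (x i : ℝ) ^ 2 := by
    intro i
    have ht := sq_le_normSqTwo x i
    rw [← hu] at ht
    have hD : u ^ 2 - 2 * u + 9 ≤ (u + 1) ^ 2 - 4 * (x i : ℝ) ^ 2 := by nlinarith
    have e : (u + 1) / ((u + 1) ^ 2 - 4 * (x i : ℝ) ^ 2) = 1 / (u + 1) +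
        4 / ((u + 1) * ((u + 1) ^ 2 - 4 * (x i : ℝ) ^ 2)) * (x i : ℝ) ^ 2 := by
      have : (u + 1) ^ 2 - 4 * (x i : ℝ) ^ 2 ≠ 0 := by linarith
      field_simp
      ring
    rw [e]
    gcongr
  refine (Finset.sum_le_sum fun i _ => h i).trans ?_
  rw [Finset.sum_add_distrib, ← Finset.mul_sum]
  have hs : ∑ i, (x i : ℝ) ^ 2 = u - 2 := by rw [hu]; unfold normSqTwo; ring
  rw [hs]
  simp only [Finset.sum_const, Finset.card_univ, Fintype.card_fin, nsmul_eq_mul]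
  -- This is where the shift by two matters: the claim is `u (u - 2) ≤ u ^ 2 - 2 u + 9`. With a
  -- smaller shift the analogous inequality fails for large `u`.
  have : 4 / ((u + 1) * (u ^ 2 - 2 * u + 9)) * (u - 2) ≤ 4 / ((u + 1) * u) := by
    rw [div_mul_eq_mul_div, div_le_div_iff₀ (by positivity) (by positivity)]
    nlinarith
  have e2 : (d : ℝ) * (1 / (u + 1)) = d / (u + 1) := by ring
  rw [e2]
  linarith

/-- Since `d/u - d/(u+1) = d/((u+1)u)`, the error `4/((u+1)u)` of `sum_denom_le` is absorbed exactly
when `d ≥ 4`. -/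
theorem avg_inv_le {d : ℕ} (hd : 4 ≤ d) (x : Fin d → ℤ) :
    avg (fun z => 1 / normSqTwo z) x ≤ 1 / normSqTwo x := by
  have hd' : (4 : ℝ) ≤ d := by exact_mod_cast hd
  have hs := sum_denom_le x
  have hu2 : 2 ≤ normSqTwo x := two_le_normSqTwo x
  unfold avg
  have e : ∀ i, 1 / normSqTwo (x + Pi.single i 1) + 1 / normSqTwo (x - Pi.single i 1) =
      2 * ((normSqTwo x + 1) / ((normSqTwo x + 1) ^ 2 - 4 * (x i : ℝ) ^ 2)) := by
    intro i
    obtain ⟨h1, h2⟩ := denom_pos (sq_le_normSqTwo x i)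
    rw [sub_eq_add_neg x, ← Pi.single_neg, normSqTwo_add_single, normSqTwo_add_single]
    have h3 : (normSqTwo x + 1) ^ 2 - 4 * (x i : ℝ) ^ 2 ≠ 0 := by nlinarith
    have h4 : normSqTwo x + 2 * (1 : ℤ) * x i + (1 : ℤ) ^ 2 ≠ 0 := by push_cast; linarith
    have h5 : normSqTwo x + 2 * (-1 : ℤ) * x i + (-1 : ℤ) ^ 2 ≠ 0 := by push_cast; linarith
    rw [div_add_div _ _ h4 h5, ← mul_div_assoc, div_eq_div_iff (mul_ne_zero h4 h5) h3]
    push_cast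
    ring
  simp only [e, ← Finset.mul_sum]
  set u := normSqTwo x
  have : (d : ℝ) / (u + 1) + 4 / ((u + 1) * u) ≤ d / u := by
    have : (d : ℝ) / u = d / (u + 1) + d / ((u + 1) * u) := by field_simp
    rw [this]
    gcongr
  rw [div_le_iff₀ (by positivity)]
  have e3 : 1 / u * (2 * (d : ℝ)) = 2 * (d / u) := by ring
  rw [e3]
  linarith

/-- With neighbour values `a`, `b` and central value `m`, the inequality `4m(a+b) ≤ (a+b)^2 + 4m^2`
removes the square roots: `a^2 + b^2` is rational and `2ab` is bounded by the arithmetic-geometric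
mean inequality. -/
theorem sqrt_inv_add_le {w t u : ℝ} (hw : 0 < w) (hu : 0 < u) (h1 : 0 < w + 2 * t)
    (h2 : 0 < w - 2 * t) :
    √(1 / (w + 2 * t)) + √(1 / (w - 2 * t)) ≤
      √(1 / u) * (u / 4 * (3 * (w / (w ^ 2 - 4 * t ^ 2)) + 1 / w) + 1) := by
  have hD : 0 < w ^ 2 - 4 * t ^ 2 := by nlinarith
  set D := w ^ 2 - 4 * t ^ 2 with hDd
  set a := √(1 / (w + 2 * t)) with ha
  set b := √(1 / (w - 2 * t)) with hb
  set m := √(1 / u) with hm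
  have ha2 : a ^ 2 = 1 / (w + 2 * t) := Real.sq_sqrt (by positivity)
  have hb2 : b ^ 2 = 1 / (w - 2 * t) := Real.sq_sqrt (by positivity)
  have hm2 : m ^ 2 = 1 / u := Real.sq_sqrt (by positivity)
  have hm0 : 0 < m := Real.sqrt_pos.2 (by positivity)
  have hsum : a ^ 2 + b ^ 2 = 2 * (w / D) := by
    rw [ha2, hb2, hDd]
    have : w ^ 2 - 4 * t ^ 2 ≠ 0 := hD.ne'
    have := h1.ne'
    have := h2.ne'
    rw [div_add_div _ _ (by assumption) (by assumption), ← mul_div_assoc, div_eq_div_iff (by positivity) (by assumption)]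
    ring
  have hab : (a * b) ^ 2 = w / D * (1 / w) := by
    rw [mul_pow, ha2, hb2, hDd]
    have : w ^ 2 - 4 * t ^ 2 ≠ 0 := hD.ne'
    have := h1.ne'
    have := h2.ne'
    rw [div_mul_div_comm, div_mul_div_comm, div_eq_div_iff (by positivity) (by positivity)]
    ring
  have hprod : 2 * (a * b) ≤ w / D + 1 / w := by
    have hp : 0 ≤ w / D + 1 / w := by positivity
    nlinarith [sq_nonneg (w / D - 1 / w)]
  have hsq : (a + b) ^ 2 ≤ 3 * (w / D) + 1 / w := by nlinarith
  have hkey : 4 * m * (a + b) ≤ (a + b) ^ 2 + 4 * m ^ 2 := by nlinarith [sq_nonneg (a + b - 2 * m)]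
  have hmu : m ^ 2 * u = 1 := by rw [hm2]; field_simp
  have : 4 * m * (a + b) ≤ 4 * m * (m * (u / 4 * (3 * (w / D) + 1 / w) + 1)) := by
    have : 4 * m * (m * (u / 4 * (3 * (w / D) + 1 / w) + 1)) =
      (m ^ 2 * u) * (3 * (w / D) + 1 / w) + 4 * m ^ 2 := by ring
    rw [this, hmu]; linarith
  exact le_of_mul_le_mul_left this (by positivity)

theorem avg_sqrt_inv_le (x : Fin 3 → ℤ) :
    avg (fun z => √(1 / normSqTwo z)) x ≤ √(1 / normSqTwo x) := by
  have hs := sum_denom_le x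
  have hu2 : 2 ≤ normSqTwo x := two_le_normSqTwo x
  unfold avg
  set u := normSqTwo x with hu
  have e : ∀ i, √(1 / normSqTwo (x + Pi.single i 1)) + √(1 / normSqTwo (x - Pi.single i 1)) ≤
      √(1 / u) * (u / 4 * (3 * ((u + 1) / ((u + 1) ^ 2 - 4 * (x i : ℝ) ^ 2)) + 1 / (u + 1)) + 1) := by
    intro i
    obtain ⟨h1, h2⟩ := denom_pos (sq_le_normSqTwo x i)
    rw [sub_eq_add_neg x, ← Pi.single_neg, normSqTwo_add_single, normSqTwo_add_single]
    have := sqrt_inv_add_le (w := u + 1) (u := u) (by linarith) (by linarith) h1 h2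
    have e1 : u + 2 * ((1 : ℤ) : ℝ) * x i + ((1 : ℤ) : ℝ) ^ 2 = u + 1 + 2 * x i := by
      push_cast; ring
    have e2 : u + 2 * ((-1 : ℤ) : ℝ) * x i + ((-1 : ℤ) : ℝ) ^ 2 = u + 1 - 2 * x i := by
      push_cast; ring
    rw [← hu, e1, e2]
    exact this
  rw [div_le_iff₀ (by positivity)]
  refine (Finset.sum_le_sum fun i _ => e i).trans ?_
  rw [← Finset.mul_sum]
  gcongr
  simp only [Finset.sum_add_distrib, ← Finset.mul_sum]
  simp only [Finset.sum_const, Finset.card_univ, Fintype.card_fin, nsmul_eq_mul]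
  set T := ∑ i, (u + 1) / ((u + 1) ^ 2 - 4 * (x i : ℝ) ^ 2)
  -- Inserting the bound of `sum_denom_le` gives exactly 3, with no room to spare.
  have h3 : u / 4 * (3 * T + (3 : ℕ) * (1 / (u + 1))) ≤ 3 := by
    have : u / 4 * (3 * T + (3 : ℕ) * (1 / (u + 1))) ≤ u / 4 * (3 * ((3 : ℕ) / (u + 1) + 4 / ((u + 1) * u))
      + (3 : ℕ) * (1 / (u + 1))) := by gcongr
    refine this.trans (le_of_eq ?_)
    push_cast
    field_simp
    ring
  push_cast at h3 ⊢
  linarith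

theorem avg_lt_zero {d : ℕ} (hd : d ≠ 0) {F : ℝ → ℝ} (hF : F 3 < F 2) :
    avg (fun z : Fin d → ℤ => F (normSqTwo z)) 0 < F (normSqTwo (0 : Fin d → ℤ)) := by
  have h0 : normSqTwo (0 : Fin d → ℤ) = 2 := by simp [normSqTwo]
  have : avg (fun z : Fin d → ℤ => F (normSqTwo z)) 0 = avg (fun _ : Fin d → ℤ => F 3) 0 := by
    apply avg_congr
    intro i
    rw [sub_eq_add_neg, ← Pi.single_neg, normSqTwo_add_single, normSqTwo_add_single, h0]
    norm_num
  rw [this, avg_const hd, h0]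
  exact hF

/-- The exponent of the polynomial decay of the Green function used below. -/
def decayExp (d : ℕ) : ℕ := if d = 3 then 1 else 2

/-- One function serves both for transience and for decay. In dimension at least five the true decay
is faster than the power 2, but 2 already suffices for exponential decay of connections. -/
theorem exists_superharmonic {d : ℕ} (hd : 3 ≤ d) : ∃ f : (Fin d → ℤ) → ℝ, (∀ x, 0 ≤ f x) ∧
    (∀ x, avg f x ≤ f x) ∧ avg f 0 < f 0 ∧ (∀ x, f x ≤ 1) ∧
    ∀ x : Fin d → ℤ, ∀ i, ∀ s : ℝ, 0 < s → s ≤ |(x i : ℝ)| → f x ≤ 1 / s ^ decayExp d := by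
  rcases hd.eq_or_lt with h3 | h4
  · subst h3
    refine ⟨fun z => √(1 / normSqTwo z), fun x => Real.sqrt_nonneg _, avg_sqrt_inv_le,
      avg_lt_zero (by norm_num) (F := fun u => √(1 / u)) (Real.sqrt_lt_sqrt (by norm_num)
        (by norm_num)), fun x => ?_, fun x i s hs h => ?_⟩
    · rw [Real.sqrt_le_one, div_le_one] <;> linarith [two_le_normSqTwo x]
    · have := sq_le_normSqTwo x i
      have h' : s ^ 2 ≤ (x i : ℝ) ^ 2 := by rw [← sq_abs (x i : ℝ)]; gcongr
      simp only [decayExp, if_true, pow_one]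
      apply Real.sqrt_le_iff.2 ⟨by positivity, ?_⟩
      rw [div_pow, one_pow]
      gcongr
      linarith
  · refine ⟨fun z => 1 / normSqTwo z, fun x => ?_, avg_inv_le h4,
      avg_lt_zero (by omega) (F := fun u => 1 / u) (by norm_num), fun x => ?_,
      fun x i s hs h => ?_⟩
    · have := two_le_normSqTwo x; positivity
    · rw [div_le_one] <;> linarith [two_le_normSqTwo x]
    · have := sq_le_normSqTwo x i
      have h' : s ^ 2 ≤ (x i : ℝ) ^ 2 := by rw [← sq_abs (x i : ℝ)]; gcongr
      rw [decayExp, if_neg (by omega)]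
      simp only
      gcongr
      linarith

theorem summable_stepProb {d : ℕ} (hd : 3 ≤ d) (x y : Fin d → ℤ) :
    Summable fun n => stepProb d n x y := by
  obtain ⟨f, h0, h1, h2, h3, -⟩ := exists_superharmonic hd
  refine summable_of_sum_range_le (c := f (x - y) / (f 0 - avg f 0))
    (fun n => stepProb_nonneg n x y) fun N => ?_
  rw [le_div_iff₀ (by linarith), mul_comm]
  exact sum_stepProb_le h0 h1 x y N

theorem green_nonneg {d : ℕ} (x y : Fin d → ℤ) : 0 ≤ green d x y :=
  tsum_nonneg fun n => stepProb_nonneg n x y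

theorem green_decay {d : ℕ} (hd : 3 ≤ d) : ∃ C : ℝ, 0 < C ∧ ∀ x y : Fin d → ℤ, ∀ i, ∀ s : ℝ,
    0 < s → s ≤ |(x i : ℝ) - y i| → green d x y ≤ C / s ^ decayExp d := by
  obtain ⟨f, h0, h1, h2, h3, h4⟩ := exists_superharmonic hd
  have hc : 0 < f 0 - avg f 0 := by linarith
  have key : ∀ x y, green d x y ≤ f (x - y) / (f 0 - avg f 0) := fun x y => by
    refine (summable_stepProb hd x y).tsum_le_of_sum_range_le fun N => ?_
    rw [le_div_iff₀ hc, mul_comm]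
    exact sum_stepProb_le h0 h1 x y N
  refine ⟨1 / (f 0 - avg f 0), by positivity, fun x y i s hs h => (key x y).trans ?_⟩
  rw [div_div, mul_comm, ← div_div]
  gcongr
  exact h4 _ i s hs (by simpa using h)

/-! ### Hitting distributions of finite sets -/

theorem tsum_avg {d : ℕ} {u : ℕ → (Fin d → ℤ) → ℝ} (x : Fin d → ℤ)
    (hu : ∀ z, Summable fun n => u n z) :
    ∑' n, avg (u n) x = avg (fun z => ∑' n, u n z) x := by
  unfold avg
  rw [tsum_div_const, Summable.tsum_finsetSum fun i _ => (hu _).add (hu _)]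
  congr 1
  exact Finset.sum_congr rfl fun i _ => (hu _).tsum_add (hu _)

/-- The tail `∑_{m ≥ n} P_x[X_m = y]` of the Green function. -/
def greenTail (d n : ℕ) (x y : Fin d → ℤ) : ℝ := ∑' m, stepProb d (m + n) x y

theorem greenTail_succ {d : ℕ} (hd : 3 ≤ d) (n : ℕ) (x y : Fin d → ℤ) :
    greenTail d (n + 1) x y = avg (fun z => greenTail d n z y) x := by
  unfold greenTail
  rw [← tsum_avg x fun z => (summable_nat_add_iff n).2 (summable_stepProb hd z y)]
  rfl

theorem greenTail_nonneg {d : ℕ} (n : ℕ) (x y : Fin d → ℤ) : 0 ≤ greenTail d n x y :=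
  tsum_nonneg fun _ => stepProb_nonneg _ x y

theorem green_eq {d : ℕ} (hd : 3 ≤ d) (x y : Fin d → ℤ) :
    green d x y = (if x = y then 1 else 0) + avg (fun z => green d z y) x := by
  unfold green
  rw [(summable_stepProb hd x y).tsum_eq_zero_add, ← tsum_avg x fun z => summable_stepProb hd z y]
  rfl

open Classical in
/-- The probability that the walk from `x` has hit `K` by time `n`, and that it did so at `y`. -/
def hitProb {d : ℕ} (K : Finset (Fin d → ℤ)) : ℕ → (Fin d → ℤ) → (Fin d → ℤ) → ℝ
  | 0, x, y => if x ∈ K ∧ x = y then 1 else 0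
  | n + 1, x, y =>
      if x ∈ K then (if x = y then 1 else 0) else avg (fun z => hitProb K n z y) x

section Hitting

variable {d : ℕ} (K : Finset (Fin d → ℤ))

theorem hitProb_of_mem {x : Fin d → ℤ} (hx : x ∈ K) (n : ℕ) (y : Fin d → ℤ) :
    hitProb K n x y = if x = y then 1 else 0 := by
  cases n <;> simp [hitProb, hx]

theorem hitProb_zero_of_notMem {x : Fin d → ℤ} (hx : x ∉ K) (y : Fin d → ℤ) :
    hitProb K 0 x y = 0 := by
  simp [hitProb, hx]

theorem hitProb_succ_of_notMem {x : Fin d → ℤ} (hx : x ∉ K) (n : ℕ) (y : Fin d → ℤ) :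
    hitProb K (n + 1) x y = avg (fun z => hitProb K n z y) x := by
  simp [hitProb, hx]

theorem hitProb_nonneg (n : ℕ) (x y : Fin d → ℤ) : 0 ≤ hitProb K n x y := by
  induction n generalizing x with
  | zero => simp only [hitProb]; split_ifs <;> norm_num
  | succ n ih =>
    by_cases hx : x ∈ K
    · rw [hitProb_of_mem K hx]; split_ifs <;> norm_num
    · rw [hitProb_succ_of_notMem K hx]; exact avg_nonneg fun z => ih z

theorem hitProb_mono_succ (n : ℕ) (x y : Fin d → ℤ) :
    hitProb K n x y ≤ hitProb K (n + 1) x y := by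
  by_cases hx : x ∈ K
  · rw [hitProb_of_mem K hx, hitProb_of_mem K hx]
  · rw [hitProb_succ_of_notMem K hx]
    induction n generalizing x with
    | zero => rw [hitProb_zero_of_notMem K hx]; exact avg_nonneg fun z => hitProb_nonneg K 0 z y
    | succ n ih =>
      rw [hitProb_succ_of_notMem K hx]
      have : ∀ z, hitProb K n z y ≤ hitProb K (n + 1) z y := by
        intro z
        by_cases hz : z ∈ K
        · rw [hitProb_of_mem K hz, hitProb_of_mem K hz]
        · rw [hitProb_succ_of_notMem K hz]; exact ih z hz
      exact avg_mono fun i => ⟨this _, this _⟩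

theorem sum_hitProb_of_mem {x : Fin d → ℤ} (hx : x ∈ K) (n : ℕ) :
    ∑ y ∈ K, hitProb K n x y = 1 := by
  simp [hitProb_of_mem K hx, hx]

theorem sum_hitProb_succ_of_notMem {x : Fin d → ℤ} (hx : x ∉ K) (n : ℕ) :
    ∑ y ∈ K, hitProb K (n + 1) x y = avg (fun z => ∑ y ∈ K, hitProb K n z y) x := by
  simp only [hitProb_succ_of_notMem K hx]
  rw [avg_sum]

theorem sum_hitProb_le_one (hd : d ≠ 0) (n : ℕ) (x : Fin d → ℤ) :
    ∑ y ∈ K, hitProb K n x y ≤ 1 := by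
  by_cases hx : x ∈ K
  · rw [sum_hitProb_of_mem K hx]
  · induction n generalizing x with
    | zero => simp [hitProb_zero_of_notMem K hx]
    | succ n ih =>
      rw [sum_hitProb_succ_of_notMem K hx, ← avg_const hd 1 x]
      have : ∀ z, ∑ y ∈ K, hitProb K n z y ≤ 1 := by
        intro z
        by_cases hz : z ∈ K
        · rw [sum_hitProb_of_mem K hz]
        · exact ih z hz
      exact avg_mono fun i => ⟨this _, this _⟩

/-- The difference is the expectation of `g(X_n, z)` on the event that `K` has not been hit by time
`n`, and `greenTail d n` is the same expectation without the restriction. The induction uses that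
`g(·, z)` is harmonic off `K`, because `z ∈ K`. -/
theorem green_sub_sum_hitProb (hd : 3 ≤ d) {z : Fin d → ℤ} (hz : z ∈ K) (n : ℕ) (x : Fin d → ℤ) :
    0 ≤ green d x z - ∑ y ∈ K, hitProb K n x y * green d y z ∧
      green d x z - ∑ y ∈ K, hitProb K n x y * green d y z ≤ greenTail d n x z := by
  by_cases hx : x ∈ K
  · simp [hitProb_of_mem K hx, hx, greenTail_nonneg]
  · induction n generalizing x with
    | zero => simp [hitProb_zero_of_notMem K hx, green_nonneg]; simp [greenTail, green]
    | succ n ih =>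
      have hxz : x ≠ z := fun h => hx (h ▸ hz)
      have e : green d x z - ∑ y ∈ K, hitProb K (n + 1) x y * green d y z =
          avg (fun v => green d v z - ∑ y ∈ K, hitProb K n v y * green d y z) x := by
        rw [avg_sub, avg_sum]
        simp only [avg_mul_right, hitProb_succ_of_notMem K hx]
        rw [green_eq hd x z, if_neg hxz, zero_add]
      have ih' : ∀ v, 0 ≤ green d v z - ∑ y ∈ K, hitProb K n v y * green d y z ∧
          green d v z - ∑ y ∈ K, hitProb K n v y * green d y z ≤ greenTail d n v z := by
        intro v
        by_cases hv : v ∈ K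
        · simp [hitProb_of_mem K hv, hv, greenTail_nonneg]
        · exact ih v hv
      rw [e, greenTail_succ hd]
      exact ⟨avg_nonneg fun v => (ih' v).1, avg_mono fun i => ⟨(ih' _).2, (ih' _).2⟩⟩

theorem hitProb_eq_zero {W : Set (Fin d → ℤ)}
    (hW : ∀ w ∈ W, w ∉ K → ∀ i, w + Pi.single i 1 ∈ W ∧ w - Pi.single i 1 ∈ W)
    {x y : Fin d → ℤ} (hx : x ∈ W) (hy : y ∉ W) (n : ℕ) : hitProb K n x y = 0 := by
  have hxy : ∀ z ∈ W, z ≠ y := fun z hz h => hy (h ▸ hz)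
  induction n generalizing x with
  | zero => simp [hitProb, hxy x hx]
  | succ n ih =>
    by_cases hxK : x ∈ K
    · rw [hitProb_of_mem K hxK, if_neg (hxy x hx)]
    · rw [hitProb_succ_of_notMem K hxK]
      have h0 : avg (fun z => hitProb K n z y) x = avg (fun z => (0 : ℝ) * 0) x :=
        avg_congr fun i => ⟨by rw [ih (hW x hx hxK i).1, zero_mul],
          by rw [ih (hW x hx hxK i).2, zero_mul]⟩
      rw [h0, avg_mul_right, mul_zero]

/-- A walk that has not yet hit `K` is still in `W`. As `W` is finite and the walk transient, the
right side tends to zero, so the hitting distribution has full mass. -/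
theorem one_sub_sum_hitProb_le (hd : d ≠ 0) {W : Finset (Fin d → ℤ)}
    (hW : ∀ w ∈ W, w ∉ K → ∀ i, w + Pi.single i 1 ∈ W ∧ w - Pi.single i 1 ∈ W)
    {x : Fin d → ℤ} (hx : x ∈ W) (n : ℕ) :
    1 - ∑ y ∈ K, hitProb K n x y ≤ ∑ y ∈ W, stepProb d n x y := by
  by_cases hxK : x ∈ K
  · rw [sum_hitProb_of_mem K hxK, sub_self]
    exact Finset.sum_nonneg fun y _ => stepProb_nonneg n x y
  · induction n generalizing x with
    | zero => simp [hitProb_zero_of_notMem K hxK, stepProb, hx]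
    | succ n ih =>
      rw [sum_hitProb_succ_of_notMem K hxK]
      simp only [stepProb_succ]
      rw [← avg_sum, ← avg_const hd 1 x, ← avg_sub]
      have : ∀ z ∈ W, 1 - ∑ y ∈ K, hitProb K n z y ≤ ∑ y ∈ W, stepProb d n z y := by
        intro z hz
        by_cases hzK : z ∈ K
        · rw [sum_hitProb_of_mem K hzK, sub_self]
          exact Finset.sum_nonneg fun y _ => stepProb_nonneg n z y
        · exact ih hz hzK
      exact avg_mono fun i => ⟨this _ (hW x hx hxK i).1, this _ (hW x hx hxK i).2⟩

/-- The hitting distribution of a finite set `K`. The last two clauses concern a set `W` that the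
walk cannot leave before hitting `K`. -/
theorem exists_hitting_weights (hd : 3 ≤ d) (x : Fin d → ℤ) :
    ∃ a : (Fin d → ℤ) → ℝ, (∀ y, 0 ≤ a y) ∧ ∑ y ∈ K, a y ≤ 1 ∧
      (∀ z ∈ K, ∑ y ∈ K, a y * green d y z = green d x z) ∧
      ∀ W : Finset (Fin d → ℤ),
        (∀ w ∈ W, w ∉ K → ∀ i, w + Pi.single i 1 ∈ W ∧ w - Pi.single i 1 ∈ W) → x ∈ W →
        (∀ y, y ∉ W → a y = 0) ∧ ∑ y ∈ K, a y = 1 := by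
  have hle : ∀ n y, y ∈ K → hitProb K n x y ≤ 1 := fun n y hy =>
    (Finset.single_le_sum (fun z _ => hitProb_nonneg K n x z) hy).trans
      (sum_hitProb_le_one K (by omega) n x)
  have hzero : ∀ n y, y ∉ K → hitProb K n x y = 0 := by
    intro n y hy
    induction n generalizing x with
    | zero =>
      simp only [hitProb]
      rw [if_neg]
      rintro ⟨h, rfl⟩
      exact hy h
    | succ n ih =>
      by_cases hxK : x ∈ K
      · rw [hitProb_of_mem K hxK, if_neg]
        rintro rfl
        exact hy hxK
      · have ih' : ∀ v, hitProb K n v y = 0 := fun v => ih v fun n y hy =>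
          (Finset.single_le_sum (fun z _ => hitProb_nonneg K n v z) hy).trans
            (sum_hitProb_le_one K (by omega) n v)
        rw [hitProb_succ_of_notMem K hxK]
        simp [avg, ih']
  have hlim : ∀ y, ∃ l, Tendsto (fun n => hitProb K n x y) atTop (𝓝 l) := by
    intro y
    refine ⟨_, tendsto_atTop_ciSup (monotone_nat_of_le_succ fun n => hitProb_mono_succ K n x y)
      ⟨1, ?_⟩⟩
    rintro _ ⟨n, rfl⟩
    by_cases hy : y ∈ K
    · exact hle n y hy
    · simp [hzero n y hy]
  choose a ha using hlim
  have hsum : Tendsto (fun n => ∑ y ∈ K, hitProb K n x y) atTop (𝓝 (∑ y ∈ K, a y)) :=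
    tendsto_finsetSum _ fun y _ => ha y
  refine ⟨a, fun y => ge_of_tendsto' (ha y) fun n => hitProb_nonneg K n x y,
    le_of_tendsto' hsum fun n => sum_hitProb_le_one K (by omega) n x, fun z hz => ?_,
    fun W hW hx => ⟨fun y hy => ?_, ?_⟩⟩
  · have h1 : Tendsto (fun n => green d x z - ∑ y ∈ K, hitProb K n x y * green d y z) atTop
        (𝓝 (green d x z - ∑ y ∈ K, a y * green d y z)) :=
      tendsto_const_nhds.sub (tendsto_finsetSum _ fun y _ => (ha y).mul_const _)
    have h2 : Tendsto (fun n => greenTail d n x z) atTop (𝓝 0) :=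
      tendsto_sum_nat_add fun n => stepProb d n x z
    have h3 : Tendsto (fun n => green d x z - ∑ y ∈ K, hitProb K n x y * green d y z) atTop
        (𝓝 0) :=
      squeeze_zero (fun n => (green_sub_sum_hitProb K hd hz n x).1)
        (fun n => (green_sub_sum_hitProb K hd hz n x).2) h2
    linarith [tendsto_nhds_unique h1 h3]
  · have : (fun n => hitProb K n x y) = fun _ => 0 :=
      funext fun n => hitProb_eq_zero K (W := W) (fun w hw => hW w hw) hx hy n
    exact tendsto_nhds_unique (ha y) (this ▸ tendsto_const_nhds)
  · refine le_antisymm (le_of_tendsto' hsum fun n => sum_hitProb_le_one K (by omega) n x) ?_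
    have h2 : Tendsto (fun n => ∑ y ∈ W, stepProb d n x y) atTop (𝓝 (∑ y ∈ W, 0)) :=
      tendsto_finsetSum _ fun y _ => (summable_stepProb hd x y).tendsto_atTop_zero
    have := le_of_tendsto_of_tendsto' (tendsto_const_nhds.sub hsum) h2
      fun n => one_sub_sum_hitProb_le K (by omega) hW hx n
    simp at this
    linarith

end Hitting


/-! ### The domain Markov property and decoupling -/

/-- The linear functional `φ ↦ ∑_{y ∈ K} a y * φ y`. -/
def lin {d : ℕ} (K : Finset (Fin d → ℤ)) (a : (Fin d → ℤ) → ℝ) (φ : (Fin d → ℤ) → ℝ) : ℝ :=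
  ∑ y ∈ K, a y * φ y

theorem measurable_lin {d : ℕ} (K : Finset (Fin d → ℤ)) (a : (Fin d → ℤ) → ℝ) :
    Measurable (lin K a) := by
  unfold lin
  fun_prop

theorem stepProb_add {d : ℕ} (n : ℕ) (x y v : Fin d → ℤ) :
    stepProb d n (x + v) (y + v) = stepProb d n x y := by
  induction n generalizing x with
  | zero => simp [stepProb]
  | succ n ih =>
    simp only [stepProb]
    congr 1
    refine Finset.sum_congr rfl fun i _ => ?_
    rw [add_right_comm, ih, add_sub_right_comm, ih]

theorem green_add {d : ℕ} (x y v : Fin d → ℤ) : green d (x + v) (y + v) = green d x y := by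
  simp only [green, stepProb_add]

/-- A Gaussian tail bound. -/
theorem measureReal_le_abs_le {Ω : Type*} [MeasurableSpace Ω] {P : Measure Ω} {X : Ω → ℝ}
    (hX : HasGaussianLaw X P) (hmean : P[X] = 0) {v : ℝ} (hv : 0 ≤ v) (hvar : Var[X; P] ≤ v)
    {t : ℝ} (ht : 0 ≤ t) : P.real {ω | t ≤ |X ω|} ≤ 2 * Real.exp (-t ^ 2 / (2 * v)) := by
  have := hX.isProbabilityMeasure
  have hmap := hX.map_eq_gaussianReal
  have hsub : HasSubgaussianMGF X ⟨v, hv⟩ P := by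
    refine ⟨fun s => ?_, fun s => ?_⟩
    · have h := integrable_exp_mul_gaussianReal (μ := P[X]) (v := Var[X; P].toNNReal) s
      rw [← hmap] at h
      exact h.comp_aemeasurable hX.aemeasurable
    · rw [mgf_gaussianReal hmap, hmean, zero_mul, zero_add]
      rw [Real.coe_toNNReal _ (variance_nonneg _ _)]
      gcongr
      exact hvar
  have h1 := hsub.measure_ge_le ht
  have h2 := hsub.neg.measure_ge_le ht
  have hset : {ω | t ≤ |X ω|} = {ω | t ≤ X ω} ∪ {ω | t ≤ (-X) ω} := by
    ext ω; simp [le_abs]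
  rw [hset, two_mul]
  exact (measureReal_union_le _ _).trans (add_le_add h1 h2)

section Field

variable {d : ℕ} {μ : Measure ((Fin d → ℤ) → ℝ)}

theorem IsGFF.isProbabilityMeasure (hμ : IsGFF μ) : IsProbabilityMeasure μ :=
  hμ.gaussian.isProbabilityMeasure

theorem IsGFF.memLp (hμ : IsGFF μ) (x : Fin d → ℤ) :
    MemLp (fun φ : (Fin d → ℤ) → ℝ => φ x) 2 μ :=
  (hμ.gaussian.hasGaussianLaw_eval x).memLp_two

theorem IsGFF.memLp_lin (hμ : IsGFF μ) (K : Finset (Fin d → ℤ)) (a : (Fin d → ℤ) → ℝ) :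
    MemLp (lin K a) 2 μ :=
  memLp_finsetSum _ fun y _ => (hμ.memLp y).const_mul (a y)

theorem IsGFF.cov (hμ : IsGFF μ) (x y : Fin d → ℤ) :
    cov[fun φ : (Fin d → ℤ) → ℝ => φ x, fun φ : (Fin d → ℤ) → ℝ => φ y; μ] = green d x y := by
  have := hμ.isProbabilityMeasure
  rw [covariance_eq_sub (hμ.memLp x) (hμ.memLp y), hμ.centered x, zero_mul, sub_zero]
  exact hμ.covariance x y

theorem IsGFF.cov_lin_left (hμ : IsGFF μ) (K : Finset (Fin d → ℤ)) (a : (Fin d → ℤ) → ℝ)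
    (z : Fin d → ℤ) : cov[lin K a, fun φ : (Fin d → ℤ) → ℝ => φ z; μ] =
      ∑ y ∈ K, a y * green d y z := by
  have := hμ.isProbabilityMeasure
  unfold lin
  rw [covariance_fun_sum_left' (fun y _ => (hμ.memLp y).const_mul (a y)) (hμ.memLp z)]
  simp only [covariance_const_mul_left, hμ.cov]

theorem IsGFF.cov_lin_lin (hμ : IsGFF μ) (K : Finset (Fin d → ℤ)) (a : (Fin d → ℤ) → ℝ) :
    cov[lin K a, lin K a; μ] = ∑ z ∈ K, a z * ∑ y ∈ K, a y * green d y z := by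
  have := hμ.isProbabilityMeasure
  have : cov[lin K a, lin K a; μ] = cov[lin K a, fun φ => ∑ z ∈ K, a z * φ z; μ] := rfl
  rw [this, covariance_fun_sum_right' (fun y _ => (hμ.memLp y).const_mul (a y)) (hμ.memLp_lin K a)]
  simp only [covariance_const_mul_right, hμ.cov_lin_left]

theorem IsGFF.integral_lin (hμ : IsGFF μ) (K : Finset (Fin d → ℤ)) (a : (Fin d → ℤ) → ℝ) :
    ∫ φ, lin K a φ ∂μ = 0 := by
  have := hμ.isProbabilityMeasure
  unfold lin
  rw [integral_finsetSum _ fun y _ =>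
    ((hμ.gaussian.hasGaussianLaw_eval y).integrable.const_mul (a y))]
  simp [integral_const_mul, hμ.centered]

/-- A family of finite linear combinations of the field is a Gaussian process. -/
theorem IsGFF.isGaussianProcess_lin (hμ : IsGFF μ) {S : Type*} (K : S → Finset (Fin d → ℤ))
    (a : S → (Fin d → ℤ) → ℝ) : IsGaussianProcess (fun s => lin (K s) (a s)) μ :=
  hμ.gaussian.of_isGaussianProcess fun s => ⟨K s,
    ∑ y : K s, a s y • ContinuousLinearMap.proj y, fun φ => by
      simp only [lin, sum_apply, smul_apply,
        ContinuousLinearMap.proj_apply, Finset.restrict, smul_eq_mul]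
      exact (Finset.sum_coe_sort (K s) fun y => a s y * φ y).symm⟩

theorem IsGFF.hasGaussianLaw_lin (hμ : IsGFF μ) (K : Finset (Fin d → ℤ))
    (a : (Fin d → ℤ) → ℝ) : HasGaussianLaw (lin K a) μ :=
  (hμ.isGaussianProcess_lin (S := Unit) (fun _ => K) fun _ => a).hasGaussianLaw_eval ()

/-- The domain Markov property: the field minus its harmonic average over `K` is independent of
the field on `K`. -/
theorem IsGFF.indepFun_sub_lin (hμ : IsGFF μ) (K : Finset (Fin d → ℤ))
    (a : (Fin d → ℤ) → (Fin d → ℤ) → ℝ)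
    (ha : ∀ x, ∀ z ∈ K, ∑ y ∈ K, a x y * green d y z = green d x z) :
    IndepFun (fun φ (s : K) => φ s) (fun φ x => φ x - lin K (a x) φ) μ := by
  have := hμ.isProbabilityMeasure
  classical
  refine IsGaussianProcess.indepFun_of_covariance_eq_zero (X := fun (s : K) φ => φ s)
    (Y := fun x φ => φ x - lin K (a x) φ) ?_ (fun s => (measurable_pi_apply _).aemeasurable)
    (fun x => ((measurable_pi_apply x).sub (measurable_lin _ _)).aemeasurable) fun s x => ?_
  · have h := hμ.isGaussianProcess_lin (S := K ⊕ (Fin d → ℤ))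
      (Sum.elim (fun s => {(s : Fin d → ℤ)}) fun x => insert x K)
      (Sum.elim (fun _ _ => 1) fun x y =>
        (if y = x then 1 else 0) - if y ∈ K then a x y else 0)
    convert h using 2 with i
    rcases i with s | x
    · ext φ; simp [lin]
    · ext φ
      simp only [Sum.elim_inr, lin, sub_mul, Finset.sum_sub_distrib]
      congr 1
      · simp
      · rw [← Finset.sum_subset (Finset.subset_insert x K)]
        · exact Finset.sum_congr rfl fun y hy => by simp [hy]
        · intro y _ hy; simp [hy]
  -- The family is jointly Gaussian, so zero covariance suffices; it vanishes because the weights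
  -- reproduce `g(x, ·)` on `K`.
  · rw [covariance_comm, covariance_fun_sub_left (hμ.memLp x) (hμ.memLp_lin _ _) (hμ.memLp s),
      hμ.cov]
    have h := hμ.cov_lin_left K (a x) s
    rw [ha x s s.2] at h
    simp only [h, sub_self]

/-- Both laws are Gaussian, so it is enough to compare the mean and variance of each linear
functional; the Green function is translation invariant. -/
theorem IsGFF.map_restrict_add (hμ : IsGFF μ) (K : Finset (Fin d → ℤ)) (v : Fin d → ℤ) :
    μ.map (fun φ (k : K) => φ (k + v)) = μ.map (fun φ (k : K) => φ k) := by
  have := hμ.isProbabilityMeasure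
  have h0 : HasGaussianLaw (fun (φ : (Fin d → ℤ) → ℝ) (k : K) => φ k) μ :=
    hμ.gaussian.hasGaussianLaw K
  have hg := hμ.gaussian.comp_right (fun x : Fin d → ℤ => x + v)
  have h1 : HasGaussianLaw (fun (φ : (Fin d → ℤ) → ℝ) (k : K) => φ (k + v)) μ :=
    hg.hasGaussianLaw K
  have := h0.isGaussian_map
  have := h1.isGaussian_map
  refine Measure.ext_of_charFunDual (funext fun L => ?_)
  rw [h0.charFunDual_map_eq_fun, h1.charFunDual_map_eq_fun]
  classical
  obtain ⟨c, hL⟩ : ∃ c : K → ℝ, ∀ f : K → ℝ, L f = ∑ k, c k * f k := by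
    refine ⟨fun k => L (Pi.single k 1), fun f => ?_⟩
    conv_lhs => rw [← Finset.univ_sum_single f]
    rw [map_sum]
    refine Finset.sum_congr rfl fun k _ => ?_
    have : Pi.single k (f k) = f k • (Pi.single k 1 : K → ℝ) := by
      rw [← Pi.single_smul]; simp
    rw [this, map_smul, smul_eq_mul, mul_comm]
  have key : ∀ w : Fin d → ℤ, ∫ φ : (Fin d → ℤ) → ℝ, L (fun k : K => φ (k + w)) ∂μ = 0 ∧
      Var[fun φ : (Fin d → ℤ) → ℝ => L (fun k : K => φ (k + w)); μ] =
        ∑ k : K, ∑ l : K, c k * (c l * green d k l) := by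
    intro w
    simp only [hL]
    constructor
    · rw [integral_finsetSum _ fun y _ =>
        ((hμ.gaussian.hasGaussianLaw_eval _).integrable.const_mul _)]
      simp [integral_const_mul, hμ.centered]
    · rw [← covariance_self, covariance_fun_sum_fun_sum]
      · refine Finset.sum_congr rfl fun k _ => Finset.sum_congr rfl fun l _ => ?_
        rw [covariance_const_mul_left, covariance_const_mul_right, hμ.cov, green_add]
      · exact fun k => (hμ.memLp _).const_mul _
      · exact fun k => (hμ.memLp _).const_mul _
      · refine Measurable.aemeasurable (Finset.measurable_fun_sum _ fun k _ => ?_)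
        have hm : Measurable fun φ : (Fin d → ℤ) → ℝ => φ (k + w) := measurable_pi_apply _
        exact hm.const_mul (c k)
  have k0 := key 0
  simp only [add_zero] at k0
  rw [(key v).1, (key v).2, k0.1, k0.2]

/-- A set of site configurations depends only on the sites of `K`. -/
def DependsOn (E : Set (Set (Fin d → ℤ))) (K : Finset (Fin d → ℤ)) : Prop :=
  ∀ S T : Set (Fin d → ℤ), S ∩ K = T ∩ K → (S ∈ E ↔ T ∈ E)

/-- The field configurations on `K` whose level set lies in `E`. -/
def localEvent (E : Set (Set (Fin d → ℤ))) (K : Finset (Fin d → ℤ)) (h : ℝ) : Set (K → ℝ) :=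
  {f | {x | ∃ hx : x ∈ K, h ≤ f ⟨x, hx⟩} ∈ E}

/-- The event is the preimage of a subset of the finite set `{0,1}^K`, so no regularity of `E` is
required. -/
theorem measurableSet_localEvent (E : Set (Set (Fin d → ℤ))) (K : Finset (Fin d → ℤ)) (h : ℝ) :
    MeasurableSet (localEvent E K h) := by
  classical
  have hm : Measurable fun (f : K → ℝ) (k : K) => decide (h ≤ f k) := by
    refine measurable_pi_lambda _ fun k => ?_
    refine measurable_to_bool ?_
    have : (fun f : K → ℝ => decide (h ≤ f k)) ⁻¹' {true} = {f | h ≤ f k} := by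
      ext f; simp
    rw [this]
    exact measurableSet_le measurable_const (measurable_pi_apply k)
  have : localEvent E K h = (fun (f : K → ℝ) (k : K) => decide (h ≤ f k)) ⁻¹'
      {b | {x | ∃ hx : x ∈ K, b ⟨x, hx⟩ = true} ∈ E} := by
    ext f
    simp [localEvent]
  rw [this]
  exact hm (Set.toFinite _).measurableSet

theorem DependsOn.mem_iff {E : Set (Set (Fin d → ℤ))} {K : Finset (Fin d → ℤ)}
    (hE : DependsOn E K) (h : ℝ) (φ : (Fin d → ℤ) → ℝ) :
    excursionSet h φ ∈ E ↔ (fun k : K => φ k) ∈ localEvent E K h := by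
  refine hE _ _ ?_
  ext x
  simp only [excursionSet, Set.mem_inter_iff, Set.mem_ofPred_eq, Finset.mem_coe, exists_prop]
  tauto

theorem DependsOn.setOf_eq {E : Set (Set (Fin d → ℤ))} {K : Finset (Fin d → ℤ)}
    (hE : DependsOn E K) (h : ℝ) :
    {φ | excursionSet h φ ∈ E} = (fun φ (k : K) => φ k) ⁻¹' localEvent E K h :=
  Set.ext fun φ => hE.mem_iff h φ

theorem DependsOn.measurableSet {E : Set (Set (Fin d → ℤ))} {K : Finset (Fin d → ℤ)}
    (hE : DependsOn E K) (h : ℝ) : MeasurableSet {φ | excursionSet h φ ∈ E} := by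
  rw [hE.setOf_eq]
  exact (measurable_pi_lambda _ fun k => measurable_pi_apply _) (measurableSet_localEvent E K h)

theorem IsGFF.measureReal_translate (hμ : IsGFF μ) {E : Set (Set (Fin d → ℤ))}
    {K : Finset (Fin d → ℤ)} (hE : DependsOn E K) (h : ℝ) (v : Fin d → ℤ) :
    μ.real {φ | excursionSet h (fun x => φ (x + v)) ∈ E} = μ.real {φ | excursionSet h φ ∈ E} := by
  have h1 : {φ : (Fin d → ℤ) → ℝ | excursionSet h (fun x => φ (x + v)) ∈ E} =
      (fun φ (k : K) => φ (k + v)) ⁻¹' localEvent E K h :=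
    Set.ext fun φ => hE.mem_iff h fun x => φ (x + v)
  rw [h1, hE.setOf_eq, measureReal_def, measureReal_def,
    ← Measure.map_apply (by fun_prop) (measurableSet_localEvent E K h),
    ← Measure.map_apply (by fun_prop) (measurableSet_localEvent E K h), hμ.map_restrict_add]

/-- The decoupling inequality, with sprinkling of the level by `ε`. -/
theorem IsGFF.decoupling (hμ : IsGFF μ) (hd : 3 ≤ d) {E₁ E₂ : Set (Set (Fin d → ℤ))}
    {K₁ K₂ : Finset (Fin d → ℤ)} (hE₁ : DependsOn E₁ K₁) (hE₂ : DependsOn E₂ K₂)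
    (hinc : ∀ S T : Set (Fin d → ℤ), S ⊆ T → S ∈ E₂ → T ∈ E₂) {v : ℝ} (hv : 0 ≤ v)
    (hgreen : ∀ x ∈ K₂, ∀ y ∈ K₁, green d x y ≤ v) (h : ℝ) {ε : ℝ} (hε : 0 ≤ ε) :
    μ.real {φ | excursionSet (h + ε) φ ∈ E₁ ∧ excursionSet (h + ε) φ ∈ E₂} ≤
      μ.real {φ | excursionSet (h + ε) φ ∈ E₁} * μ.real {φ | excursionSet h φ ∈ E₂} +
        2 * (K₂.card * (2 * Real.exp (-(ε / 2) ^ 2 / (2 * v)))) := by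
  have := hμ.isProbabilityMeasure
  choose a ha0 ha1 ha2 _ using exists_hitting_weights K₁ hd
  set η : (Fin d → ℤ) → ((Fin d → ℤ) → ℝ) → ℝ := fun x => lin K₁ (a x) with hη
  -- The bad event: somewhere on `K₂` the harmonic average from `K₁` reaches half the sprinkling.
  set G : Set ((Fin d → ℤ) → ℝ) := ⋃ x ∈ K₂, {φ | ε / 2 ≤ |η x φ|} with hG
  set ψ : ((Fin d → ℤ) → ℝ) → (Fin d → ℤ) → ℝ := fun φ x => φ x - η x φ with hψ
  have hGle : μ.real G ≤ K₂.card * (2 * Real.exp (-(ε / 2) ^ 2 / (2 * v))) := by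
    refine (measureReal_biUnion_finset_le _ _).trans ?_
    rw [← nsmul_eq_mul]
    refine Finset.sum_le_card_nsmul _ _ _ fun x hx => ?_
    refine measureReal_le_abs_le (hμ.hasGaussianLaw_lin _ _) (hμ.integral_lin _ _) hv ?_
      (by positivity)
    -- The variance of the harmonic average at `x` is `∑ z, a x z * g(x, z)`, at most `v` because
    -- the hitting weights have mass at most one.
    rw [← covariance_self (measurable_lin _ _).aemeasurable, hμ.cov_lin_lin]
    calc ∑ z ∈ K₁, a x z * ∑ y ∈ K₁, a x y * green d y z
        ≤ ∑ z ∈ K₁, a x z * v := by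
          refine Finset.sum_le_sum fun z hz => ?_
          rw [ha2 x z hz]
          exact mul_le_mul_of_nonneg_left (hgreen x hx z hz) (ha0 x z)
      _ = (∑ z ∈ K₁, a x z) * v := by rw [Finset.sum_mul]
      _ ≤ 1 * v := by gcongr; exact ha1 x
      _ = v := one_mul v
  have hind := hμ.indepFun_sub_lin K₁ a ha2
  have hnot : ∀ φ, φ ∉ G → ∀ x ∈ K₂, |η x φ| < ε / 2 := by
    intro φ hφ x hx
    by_contra hc
    exact hφ (Set.mem_biUnion (Finset.mem_coe.2 hx) (not_lt.1 hc))
  have hcomp : ∀ S T : Set (Fin d → ℤ), S ∩ K₂ ⊆ T → S ∈ E₂ → T ∈ E₂ := fun S T hST hS =>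
    hinc _ _ hST ((hE₂ _ _ (by simp [Set.inter_assoc])).1 hS)
  set A₁ := {φ : (Fin d → ℤ) → ℝ | excursionSet (h + ε) φ ∈ E₁}
  -- The intermediate level `h + ε / 2` leaves room for two comparisons off `G`: from `φ` at level
  -- `h + ε` to `ψ`, and from `ψ` back to `φ` at level `h`. Each costs one copy of the probability
  -- of `G`. Between them, `A₂` involves only `ψ` and is independent of `A₁`.
  set A₂ := {φ : (Fin d → ℤ) → ℝ | excursionSet (h + ε / 2) (ψ φ) ∈ E₂}
  have hsub1 : {φ | excursionSet (h + ε) φ ∈ E₁ ∧ excursionSet (h + ε) φ ∈ E₂} ⊆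
      (A₁ ∩ A₂) ∪ G := by
    rintro φ ⟨h1, h2⟩
    by_cases hφ : φ ∈ G
    · exact Or.inr hφ
    · refine Or.inl ⟨h1, hcomp _ _ ?_ h2⟩
      rintro x ⟨hx, hxK⟩
      have h3 := abs_lt.1 (hnot φ hφ x hxK)
      simp only [excursionSet, Set.mem_ofPred_eq, hψ] at hx ⊢
      linarith
  have hsub2 : A₂ ⊆ {φ | excursionSet h φ ∈ E₂} ∪ G := by
    intro φ h2
    by_cases hφ : φ ∈ G
    · exact Or.inr hφ
    · refine Or.inl (hcomp _ _ ?_ h2)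
      rintro x ⟨hx, hxK⟩
      have h3 := abs_lt.1 (hnot φ hφ x hxK)
      simp only [excursionSet, Set.mem_ofPred_eq, hψ] at hx ⊢
      linarith
  have hprod : μ.real (A₁ ∩ A₂) = μ.real A₁ * μ.real A₂ := by
    have e1 : A₁ = (fun φ (k : K₁) => φ k) ⁻¹' localEvent E₁ K₁ (h + ε) := hE₁.setOf_eq _
    have e2 : A₂ = ψ ⁻¹' {φ | excursionSet (h + ε / 2) φ ∈ E₂} := rfl
    rw [e1, e2, measureReal_def, measureReal_def, measureReal_def,
      hind.measure_inter_preimage_eq_mul _ _ (measurableSet_localEvent _ _ _)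
        (hE₂.measurableSet _), ENNReal.toReal_mul]
  have b1 := (measureReal_mono (μ := μ) hsub1).trans (measureReal_union_le _ _)
  have b2 := (measureReal_mono (μ := μ) hsub2).trans (measureReal_union_le _ _)
  have b3 : μ.real A₁ ≤ 1 := measureReal_le_one
  have b4 : 0 ≤ μ.real A₁ := measureReal_nonneg
  have b5 : 0 ≤ μ.real G := measureReal_nonneg
  rw [hprod] at b1
  nlinarith

end Field


/-! ### Lattice paths inside a set of sites -/

section Joined

variable {d : ℕ}

/-- The sites `u` and `v` are connected by a nearest-neighbour path inside `S`. -/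
def Joined (S : Set (Fin d → ℤ)) (u v : Fin d → ℤ) : Prop :=
  ∃ w : (lattice d).Walk u v, ∀ z ∈ w.support, z ∈ S

theorem Joined.mono {S T : Set (Fin d → ℤ)} {u v : Fin d → ℤ} (h : Joined S u v) (hST : S ⊆ T) :
    Joined T u v :=
  h.imp fun _ hw z hz => hST (hw z hz)

theorem Joined.symm {S : Set (Fin d → ℤ)} {u v : Fin d → ℤ} (h : Joined S u v) :
    Joined S v u := by
  obtain ⟨w, hw⟩ := h
  exact ⟨w.reverse, fun z hz => hw z (by simpa using hz)⟩

theorem Joined.left_mem {S : Set (Fin d → ℤ)} {u v : Fin d → ℤ} (h : Joined S u v) : u ∈ S := by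
  obtain ⟨w, hw⟩ := h
  exact hw u w.start_mem_support

theorem Joined.refl {S : Set (Fin d → ℤ)} {u : Fin d → ℤ} (h : u ∈ S) : Joined S u u :=
  ⟨.nil, by simpa using h⟩

theorem Joined.cons {S : Set (Fin d → ℤ)} {u v w : Fin d → ℤ} (hu : u ∈ S)
    (huv : (lattice d).Adj u v) (h : Joined S v w) : Joined S u w := by
  obtain ⟨p, hp⟩ := h
  refine ⟨.cons huv p, fun z hz => ?_⟩
  rw [SimpleGraph.Walk.support_cons, List.mem_cons] at hz
  rcases hz with rfl | hz
  · exact hu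
  · exact hp z hz

/-- A path that starts in `K` and ends outside of it, or on its boundary, reaches the boundary
inside `K`. -/
theorem Joined.exists_innerBoundary {S K : Set (Fin d → ℤ)} {u v : Fin d → ℤ}
    (h : Joined S u v) (hu : u ∈ K) (hv : v ∉ K ∨ v ∈ innerBoundary K) :
    ∃ z ∈ innerBoundary K, Joined (S ∩ K) u z := by
  obtain ⟨w, hw⟩ := h
  induction w with
  | nil =>
    refine ⟨_, hv.resolve_left fun h => h hu, Joined.refl ⟨hw _ (by simp), hu⟩⟩
  | @cons a b c hab p ih =>
    have ha : a ∈ S := hw a (by simp)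
    by_cases hb : b ∈ K
    · obtain ⟨z, hz, hj⟩ := ih hb hv fun z hz => hw z (by simp [hz])
      exact ⟨z, hz, hj.cons ⟨ha, hu⟩ hab⟩
    · exact ⟨a, ⟨hu, b, hb, hab⟩, Joined.refl ⟨ha, hu⟩⟩

theorem Joined.translate {S : Set (Fin d → ℤ)} {u v : Fin d → ℤ} (h : Joined S u v)
    (x : Fin d → ℤ) : Joined {z | z + x ∈ S} (u - x) (v - x) := by
  obtain ⟨w, hw⟩ := h
  induction w with
  | nil => exact Joined.refl (by simpa using hw _ (by simp))
  | @cons a b c hab p ih =>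
    refine (ih fun z hz => hw z (by simp [hz])).cons (by simpa using hw a (by simp)) ?_
    simpa [lattice] using hab

end Joined

/-! ### Box crossings and the renormalization step -/

section Crossing

variable {d : ℕ}

theorem abs_sub_le_of_adj {x y : Fin d → ℤ} (h : (lattice d).Adj x y) (i : Fin d) :
    |x i - y i| ≤ 1 := by
  have h' : ∑ i, |x i - y i| = 1 := h
  rw [← h']
  exact Finset.single_le_sum (f := fun i => |x i - y i|) (fun i _ => abs_nonneg _)
    (Finset.mem_univ i)

theorem innerBoundary_Icc {lo hi z : Fin d → ℤ} (hz : z ∈ innerBoundary (Set.Icc lo hi)) :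
    z ∈ Set.Icc lo hi ∧ ∃ i, z i = lo i ∨ z i = hi i := by
  obtain ⟨hzK, y, hy, hadj⟩ := hz
  refine ⟨hzK, ?_⟩
  by_contra! hc
  apply hy
  have h : ∀ i, lo i ≤ y i ∧ y i ≤ hi i := by
    intro i
    have h1 := abs_le.1 (abs_sub_le_of_adj hadj i)
    have h2 : lo i ≤ z i := hzK.1 i
    have h3 : z i ≤ hi i := hzK.2 i
    have h4 := hc i
    omega
  exact ⟨fun i => (h i).1, fun i => (h i).2⟩

/-- The domain `x + [-L, 2L]^d`. -/
def dom (x : Fin d → ℤ) (L : ℤ) : Finset (Fin d → ℤ) :=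
  Finset.Icc (fun i => x i - L) (fun i => x i + 2 * L)

theorem mem_dom {x z : Fin d → ℤ} {L : ℤ} : z ∈ dom x L ↔ ∀ i, x i - L ≤ z i ∧ z i ≤ x i + 2 * L := by
  simp [dom, Finset.mem_Icc, Pi.le_def, forall_and]

/-- The event that the box `x + [0, L]^d` is connected to the boundary of `x + [-L, 2L]^d`. -/
def crossing (x : Fin d → ℤ) (L : ℤ) : Set (Set (Fin d → ℤ)) :=
  {S | ∃ u, (∀ i, x i ≤ u i ∧ u i ≤ x i + L) ∧
    ∃ v ∈ innerBoundary (dom x L : Set (Fin d → ℤ)), Joined (S ∩ dom x L) u v}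

theorem dependsOn_crossing (x : Fin d → ℤ) (L : ℤ) : DependsOn (crossing x L) (dom x L) := by
  intro S T h
  change (∃ u, _ ∧ ∃ v ∈ _, Joined (S ∩ dom x L) u v) ↔ ∃ u, _ ∧ ∃ v ∈ _, Joined (T ∩ dom x L) u v
  rw [h]

theorem crossing_mono {x : Fin d → ℤ} {L : ℤ} {S T : Set (Fin d → ℤ)} (h : S ⊆ T)
    (hS : S ∈ crossing x L) : T ∈ crossing x L := by
  obtain ⟨u, hu, v, hv, hj⟩ := hS
  exact ⟨u, hu, v, hv, hj.mono (Set.inter_subset_inter_left _ h)⟩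

/-- Stopping the path just before it first leaves the domain confines it there, which is what makes
the crossing event local. -/
theorem mem_crossing {x : Fin d → ℤ} {L : ℤ} (hL : 0 ≤ L) {S : Set (Fin d → ℤ)}
    {u v : Fin d → ℤ} (hu : ∀ i, x i ≤ u i ∧ u i ≤ x i + L)
    (hv : v ∉ (dom x L : Set (Fin d → ℤ)) ∨ v ∈ innerBoundary (dom x L : Set (Fin d → ℤ)))
    (hj : Joined S u v) : S ∈ crossing x L := by
  have huD : u ∈ (dom x L : Set (Fin d → ℤ)) := by
    rw [Finset.mem_coe, mem_dom]
    intro i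
    have := hu i
    constructor <;> linarith
  exact ⟨u, hu, hj.exists_innerBoundary huD hv⟩

theorem crossing_translate {x : Fin d → ℤ} {L : ℤ} {h : ℝ} {φ : (Fin d → ℤ) → ℝ}
    (hφ : excursionSet h φ ∈ crossing x L) :
    excursionSet h (fun z => φ (z + x)) ∈ crossing 0 L := by
  obtain ⟨u, hu, v, ⟨hv, y, hy, hadj⟩, hj⟩ := hφ
  have hmem : ∀ z, z - x ∈ dom 0 L ↔ z ∈ dom x L := by
    intro z
    simp only [mem_dom, Pi.sub_apply, Pi.zero_apply]
    refine forall_congr' fun i => ?_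
    constructor <;> rintro ⟨h1, h2⟩ <;> constructor <;> linarith
  refine ⟨u - x, fun i => ?_, v - x, ⟨?_, y - x, ?_, ?_⟩, ?_⟩
  · have := hu i
    simp only [Pi.sub_apply, Pi.zero_apply]
    constructor <;> linarith
  · exact_mod_cast (hmem v).2 hv
  · rw [Finset.mem_coe, hmem]; exact hy
  · simpa [lattice] using hadj
  · refine (hj.translate x).mono ?_
    rintro z ⟨hz1, hz2⟩
    refine ⟨hz1, ?_⟩
    rw [Finset.mem_coe, ← hmem] at hz2
    simpa using hz2

/-- The corners of the `3^d` boxes covering `[0, L']^d`. -/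
def innerCorner (L L' : ℤ) (k : Fin d → Fin 3) (j : Fin d) : ℤ :=
  ![0, L, L' - L] (k j)

/-- The index set of the `2d * 7^(d-1)` boxes covering a sphere around `[0, L']^d`. -/
abbrev OuterIndex (d : ℕ) : Type := Σ i : Fin d, Bool × ({j : Fin d // j ≠ i} → Fin 7)

theorem card_outerIndex (d : ℕ) : Fintype.card (OuterIndex d) = d * (2 * 7 ^ (d - 1)) := by
  have : ∀ i : Fin d, Fintype.card {j : Fin d // j ≠ i} = d - 1 := by
    intro i
    simp [Fintype.card_subtype_compl]
  simp [OuterIndex, this]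

open Classical in
/-- The corners of the boxes covering a sphere around `[0, L']^d`. -/
def outerCorner (L L' t : ℤ) (J : OuterIndex d) (j : Fin d) : ℤ :=
  if h : j ≠ J.1 then -t + (J.2.2 ⟨j, h⟩ : ℕ) * L else if J.2.1 then L' + t else -t - L

theorem exists_offset {L r : ℤ} (h0 : 0 ≤ r) (h7 : r ≤ 7 * L) :
    ∃ m : Fin 7, (m : ℕ) * L ≤ r ∧ r ≤ (m : ℕ) * L + L := by
  by_cases h1 : r ≤ L
  · exact ⟨0, by simp; omega⟩
  by_cases h2 : r ≤ 2 * L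
  · exact ⟨1, by simp; omega⟩
  by_cases h3 : r ≤ 3 * L
  · exact ⟨2, by simp; omega⟩
  by_cases h4 : r ≤ 4 * L
  · exact ⟨3, by simp; omega⟩
  by_cases h5 : r ≤ 5 * L
  · exact ⟨4, by simp; omega⟩
  by_cases h6 : r ≤ 6 * L
  · exact ⟨5, by simp; omega⟩
  · exact ⟨6, by simp; omega⟩

/-- A crossing at scale `2L + 2s` produces two well separated crossings at scale `L`. -/
theorem exists_pair_crossing {L s : ℤ} (hs : 1 ≤ s) (hsL : 4 * s ≤ L) {S : Set (Fin d → ℤ)}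
    (hS : S ∈ crossing 0 (2 * L + 2 * s)) :
    ∃ (k : Fin d → Fin 3) (J : OuterIndex d),
      S ∈ crossing (innerCorner L (2 * L + 2 * s) k) L ∧
      S ∈ crossing (outerCorner L (2 * L + 2 * s) (2 * L + s) J) L := by
  obtain ⟨u, hu, v, hv, hj⟩ := hS
  set L' := 2 * L + 2 * s with hL'
  -- The sphere at distance `t` around `[0, L']^d` lies inside the large domain, as `t < L'`. Outer
  -- domains extend back by `L`, to distance `L + s`, while inner ones reach at most distance `L`:
  -- this leaves the gap `s`.
  set t := 2 * L + s with ht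
  simp only [Pi.zero_apply, zero_add] at hu
  replace hj := hj.mono Set.inter_subset_left
  have huK : u ∈ Set.Icc (fun _ : Fin d => -t) (fun _ => L' + t) :=
    ⟨fun i => by have := hu i; simp only; omega, fun i => by have := hu i; simp only; omega⟩
  have hvK : v ∉ Set.Icc (fun _ : Fin d => -t) (fun _ => L' + t) := by
    rw [dom, Finset.coe_Icc] at hv
    obtain ⟨-, i, hi⟩ := innerBoundary_Icc hv
    rintro ⟨h1, h2⟩
    have h1 := h1 i
    have h2 := h2 i
    simp only [Pi.zero_apply] at hi h1 h2
    omega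
  obtain ⟨z, hz, hjz⟩ := hj.exists_innerBoundary huK (Or.inl hvK)
  obtain ⟨hzK, i, hi⟩ := innerBoundary_Icc hz
  replace hjz := hjz.mono Set.inter_subset_left
  have hk : ∀ j, ∃ k : Fin 3, ![0, L, L' - L] k ≤ u j ∧ u j ≤ ![0, L, L' - L] k + L := by
    intro j
    have := hu j
    by_cases h1 : u j ≤ L
    · exact ⟨0, by simp; omega⟩
    by_cases h2 : u j ≤ 2 * L
    · exact ⟨1, by simp; omega⟩
    · exact ⟨2, by simp; omega⟩
  choose k hk using hk
  have hkr : ∀ j, 0 ≤ innerCorner L L' k j ∧ innerCorner L L' k j ≤ L' - L := by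
    intro j
    have := hk j
    unfold innerCorner
    generalize k j = c
    fin_cases c <;> simp <;> omega
  -- The box bounded by the sphere has side `L' + 2t = 6L + 4s ≤ 7L`; this is the origin of the 7
  -- and of the condition `4s ≤ L`.
  have hm : ∀ j, ∃ m : Fin 7, (m : ℕ) * L ≤ z j + t ∧ z j + t ≤ (m : ℕ) * L + L := by
    intro j
    have h1 := hzK.1 j
    have h2 := hzK.2 j
    simp only at h1 h2
    exact exists_offset (by omega) (by omega)
  choose m hm using hm
  classical
  refine ⟨k, ⟨i, decide (z i = L' + t), fun j => m j⟩, ?_, ?_⟩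
  · refine mem_crossing (by omega) (fun j => hk j) (Or.inl ?_) hjz
    rw [Finset.mem_coe, mem_dom]
    intro hc
    have := hc i
    have := hkr i
    omega
  -- Read backwards, the same path starts in the outer box and leaves its domain on the way to `u`.
  · refine mem_crossing (u := z) (v := u) (by omega) (fun j => ?_) (Or.inl ?_) hjz.symm
    · by_cases hji : j = i
      · subst hji
        simp only [outerCorner, ne_eq, not_true_eq_false, dite_false, decide_eq_true_eq]
        split_ifs with h
        · omega
        · simp only [h, or_false] at hi
          omega
      · have := hm j
        simp only [outerCorner, ne_eq, hji, not_false_eq_true, dite_true]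
        omega
    · rw [Finset.mem_coe, mem_dom]
      intro hc
      have h1 := hc i
      have h2 := hu i
      simp only [outerCorner, ne_eq, not_true_eq_false, dite_false, decide_eq_true_eq] at h1
      split_ifs at h1 <;> omega

theorem dom_separated {L s : ℤ} (hs : 1 ≤ s) (hsL : 4 * s ≤ L) (k : Fin d → Fin 3)
    (J : OuterIndex d) {x y : Fin d → ℤ}
    (hx : x ∈ dom (outerCorner L (2 * L + 2 * s) (2 * L + s) J) L)
    (hy : y ∈ dom (innerCorner L (2 * L + 2 * s) k) L) : ∃ i, s ≤ |x i - y i| := by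
  refine ⟨J.1, ?_⟩
  rw [mem_dom] at hx hy
  have h1 := hx J.1
  have h2 := hy J.1
  have hkr : 0 ≤ innerCorner L (2 * L + 2 * s) k J.1 ∧
      innerCorner L (2 * L + 2 * s) k J.1 ≤ 2 * L + 2 * s - L := by
    unfold innerCorner
    generalize k J.1 = c
    fin_cases c <;> simp <;> omega
  simp only [outerCorner, ne_eq, not_true_eq_false, dite_false] at h1
  split_ifs at h1
  · exact le_trans (by omega) (le_abs_self _)
  · exact le_trans (by omega) (neg_le_abs _)

theorem card_dom (x : Fin d → ℤ) (L : ℕ) : (dom x L).card = (3 * L + 1) ^ d := by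
  rw [dom, Pi.card_Icc]
  have : ∀ i, (Finset.Icc (x i - (L : ℤ)) (x i + 2 * L)).card = 3 * L + 1 := by
    intro i
    rw [Int.card_Icc]
    omega
  simp [this]

/-- The crossing probability at level `h` and scale `L`. -/
def crossProb (μ : Measure ((Fin d → ℤ) → ℝ)) (h : ℝ) (L : ℕ) : ℝ :=
  μ.real {φ | excursionSet h φ ∈ crossing 0 (L : ℤ)}

variable {μ : Measure ((Fin d → ℤ) → ℝ)}

theorem IsGFF.measureReal_crossing_le (hμ : IsGFF μ) (h : ℝ) (x : Fin d → ℤ) (L : ℕ) :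
    μ.real {φ | excursionSet h φ ∈ crossing x (L : ℤ)} ≤ crossProb μ h L := by
  have := hμ.isProbabilityMeasure
  rw [crossProb, ← hμ.measureReal_translate (dependsOn_crossing 0 (L : ℤ)) h x]
  exact measureReal_mono fun φ hφ => crossing_translate hφ

theorem excursionSet_anti {h h' : ℝ} (hh : h ≤ h') (φ : (Fin d → ℤ) → ℝ) :
    excursionSet h' φ ⊆ excursionSet h φ :=
  fun _ hx => hh.trans hx

theorem IsGFF.crossProb_anti (hμ : IsGFF μ) {h h' : ℝ} (hh : h ≤ h') (L : ℕ) :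
    crossProb μ h' L ≤ crossProb μ h L := by
  have := hμ.isProbabilityMeasure
  exact measureReal_mono fun φ hφ => crossing_mono (excursionSet_anti hh φ) hφ

/-- The number of pairs of boxes in the renormalization step. -/
def pairCount (d : ℕ) : ℝ := 3 ^ d * (d * (2 * 7 ^ (d - 1)))

/-- Its inverse is the threshold `7/(2d * 21^d)`, below which the quadratic recursion contracts. -/
theorem pairCount_eq {d : ℕ} (hd : d ≠ 0) : pairCount d = 2 * d * 21 ^ d / 7 := by
  obtain ⟨n, rfl⟩ := Nat.exists_eq_succ_of_ne_zero hd
  have : (21 : ℝ) ^ (n + 1) = 3 ^ (n + 1) * 7 ^ (n + 1) := by rw [← mul_pow]; norm_num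
  simp only [pairCount, Nat.succ_eq_add_one, Nat.add_sub_cancel, this]
  rw [pow_succ (7 : ℝ)]
  ring

/-- The renormalization step. -/
theorem IsGFF.crossProb_step (hμ : IsGFF μ) (hd : 3 ≤ d) {C : ℝ} (hC : 0 < C)
    (hgreen : ∀ x y : Fin d → ℤ, ∀ i, ∀ s : ℝ, 0 < s → s ≤ |(x i : ℝ) - y i| →
      green d x y ≤ C / s ^ decayExp d)
    {L s : ℕ} (hs : 1 ≤ s) (hsL : 4 * s ≤ L) (h : ℝ) {ε : ℝ} (hε : 0 ≤ ε) :
    crossProb μ (h + ε) (2 * L + 2 * s) ≤ pairCount d * (crossProb μ h L ^ 2 +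
      4 * (3 * L + 1) ^ d * Real.exp (-(ε ^ 2 * (s : ℝ) ^ decayExp d / (8 * C)))) := by
  have := hμ.isProbabilityMeasure
  have hs' : (0 : ℝ) < s := by exact_mod_cast hs
  set L' : ℤ := 2 * (L : ℤ) + 2 * s with hL'
  set t : ℤ := 2 * (L : ℤ) + s with ht
  set A : (Fin d → Fin 3) × OuterIndex d → Set ((Fin d → ℤ) → ℝ) := fun p =>
    {φ | excursionSet (h + ε) φ ∈ crossing (innerCorner L L' p.1) (L : ℤ) ∧
      excursionSet (h + ε) φ ∈ crossing (outerCorner L L' t p.2) (L : ℤ)} with hA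
  have hsub : {φ | excursionSet (h + ε) φ ∈ crossing (0 : Fin d → ℤ) ((2 * L + 2 * s : ℕ) : ℤ)} ⊆
      ⋃ p ∈ (Finset.univ : Finset ((Fin d → Fin 3) × OuterIndex d)), A p := by
    intro φ hφ
    have e : ((2 * L + 2 * s : ℕ) : ℤ) = L' := by push_cast; rfl
    rw [Set.mem_ofPred_eq, e] at hφ
    obtain ⟨k, J, h1, h2⟩ := exists_pair_crossing (by exact_mod_cast hs) (by exact_mod_cast hsL) hφ
    simp only [Set.mem_iUnion]
    exact ⟨(k, J), Finset.mem_univ _, h1, h2⟩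
  have hle : ∀ p, μ.real (A p) ≤ crossProb μ h L ^ 2 +
      4 * (3 * L + 1) ^ d * Real.exp (-(ε ^ 2 * (s : ℝ) ^ decayExp d / (8 * C))) := by
    rintro ⟨k, J⟩
    have hdec := hμ.decoupling hd (dependsOn_crossing (innerCorner L L' k) (L : ℤ))
      (dependsOn_crossing (outerCorner L L' t J) (L : ℤ))
      (fun S T hST hS => crossing_mono hST hS) (v := C / (s : ℝ) ^ decayExp d) (by positivity)
      (fun x hx y hy => by
        obtain ⟨i, hi⟩ := dom_separated (by exact_mod_cast hs) (by exact_mod_cast hsL) k J hx hy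
        exact hgreen x y i s hs' (by exact_mod_cast hi)) h hε
    have p1 := hμ.measureReal_crossing_le (h + ε) (innerCorner L L' k) L
    have p2 := hμ.measureReal_crossing_le h (outerCorner L L' t J) L
    have p3 := hμ.crossProb_anti (le_add_of_nonneg_right hε : h ≤ h + ε) L
    refine hdec.trans ?_
    rw [card_dom]
    have e1 : -(ε / 2) ^ 2 / (2 * (C / (s : ℝ) ^ decayExp d)) =
        -(ε ^ 2 * (s : ℝ) ^ decayExp d / (8 * C)) := by
      field_simp
      ring
    rw [e1, sq (crossProb μ h L)]
    have p4 : 0 ≤ μ.real {φ | excursionSet h φ ∈ crossing (outerCorner L L' t J) (L : ℤ)} :=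
      measureReal_nonneg
    have p5 : 0 ≤ crossProb μ h L := measureReal_nonneg
    push_cast
    refine add_le_add (mul_le_mul (p1.trans p3) p2 p4 p5) (le_of_eq (by ring))
  refine (measureReal_mono hsub (measure_ne_top _ _)).trans ((measureReal_biUnion_finset_le _ _).trans ?_)
  refine (Finset.sum_le_card_nsmul _ _ _ fun p _ => hle p).trans (le_of_eq ?_)
  rw [nsmul_eq_mul, Finset.card_univ, Fintype.card_prod, card_outerIndex]
  simp [pairCount]

theorem connects_box_eq (h : ℝ) (L : ℕ) :
    (connects h (box d 0 L) (innerBoundary (box d (-L) (2 * L))) : Set ((Fin d → ℤ) → ℝ)) =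
      {φ | excursionSet h φ ∈ crossing 0 (L : ℤ)} := by
  have hdom : box d (-L) (2 * L) = ((dom 0 (L : ℤ) : Finset (Fin d → ℤ)) : Set (Fin d → ℤ)) := by
    ext z
    rw [Finset.mem_coe, mem_dom]
    simp [box]
  ext φ
  constructor
  · rintro ⟨u, hu, v, hv, hw⟩
    exact mem_crossing (by positivity) (by simpa [box] using hu) (Or.inr (hdom ▸ hv)) hw
  · rintro ⟨u, hu, v, hv, hj⟩
    exact ⟨u, by simpa [box] using hu, v, hdom ▸ hv, hj.mono Set.inter_subset_left⟩

end Crossing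


/-! ### Scales, weights and the induction over scales -/

theorem exists_mul_le_two_pow_mul_rpow (e : ℝ) :
    ∃ c : ℝ, 0 < c ∧ ∀ k : ℕ, c * (k + 1) ≤ 2 ^ k * ((k : ℝ) + 1) ^ (-e) := by
  obtain ⟨m, hm⟩ := exists_nat_ge (e + 1)
  have h := (tendsto_pow_const_div_const_pow_of_one_lt m (one_lt_two (α := ℝ))).comp
    (tendsto_add_atTop_nat 1)
  obtain ⟨B, hB⟩ := h.bddAbove_range
  have hB' : ∀ k : ℕ, ((k : ℝ) + 1) ^ m ≤ max B 1 * 2 ^ (k + 1) := by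
    intro k
    have h1 := hB ⟨k, rfl⟩
    simp only [Function.comp_apply] at h1
    push_cast at h1
    rw [div_le_iff₀ (by positivity)] at h1
    exact h1.trans (by gcongr; exact le_max_left _ _)
  have hBpos : 0 < max B 1 := lt_of_lt_of_le one_pos (le_max_right _ _)
  refine ⟨1 / (2 * max B 1), by positivity, fun k => ?_⟩
  have hk : (1 : ℝ) ≤ (k : ℝ) + 1 := by linarith [(Nat.cast_nonneg k : (0 : ℝ) ≤ k)]
  have hk0 : (0 : ℝ) < (k : ℝ) + 1 := by linarith
  have h1 : ((k : ℝ) + 1) ^ (e + 1) ≤ ((k : ℝ) + 1) ^ m := by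
    rw [← Real.rpow_natCast]
    exact Real.rpow_le_rpow_of_exponent_le hk hm
  rw [Real.rpow_neg hk0.le, div_mul_eq_mul_div, one_mul, ← div_eq_mul_inv,
    div_le_div_iff₀ (by positivity) (by positivity)]
  have h2 : ((k : ℝ) + 1) * ((k : ℝ) + 1) ^ e = ((k : ℝ) + 1) ^ (e + 1) := by
    rw [Real.rpow_add_one hk0.ne', mul_comm]
  rw [h2]
  refine h1.trans ((hB' k).trans (le_of_eq ?_))
  ring

/-- A polynomial prefactor is absorbed by a large initial scale. -/
theorem eventually_error_le (d : ℕ) {K c₀ c₁ τ θ : ℝ} (hK : 0 < K) (hc₀ : 0 < c₀) (hc₁ : 0 < c₁)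
    (hθ : 0 < θ) : ∀ᶠ M : ℕ in atTop, ∀ k : ℕ, ∀ w : ℝ, c₀ * (k + 1) ≤ w →
      K * (2 ^ k * M) ^ d * Real.exp (-(c₁ * M * w)) ≤ θ * Real.exp (-(τ * (2 * w))) := by
  -- With this `η` the volume factor uses at most a quarter of the exponent `c₁ M w`. The factor
  -- `exp(2τw)` and the ratio `K/θ` use at most a quarter each.
  set η := c₁ * c₀ / (4 * (d + 1)) with hη
  have hηpos : 0 < η := by positivity
  have hlog : ∀ᶠ M : ℕ in atTop, Real.log M ≤ η * M := by
    have := (Real.isLittleO_log_id_atTop.bound hηpos)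
    filter_upwards [tendsto_natCast_atTop_atTop.eventually this] with M hM
    simp only [id, Real.norm_eq_abs, Nat.abs_cast] at hM
    exact (le_abs_self _).trans hM
  have hbig : ∀ R : ℝ, ∀ᶠ M : ℕ in atTop, R ≤ M := fun R =>
    tendsto_natCast_atTop_atTop.eventually_ge_atTop R
  filter_upwards [hlog, hbig 1, hbig (1 / η), hbig (8 * τ / c₁),
    hbig (4 * (Real.log K - Real.log θ) / (c₁ * c₀))] with M h1 h2 h3 h4 h5 k w hw
  have hM : (0 : ℝ) < M := by linarith
  rw [div_le_iff₀ hηpos] at h3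
  rw [div_le_iff₀ hc₁] at h4
  rw [div_le_iff₀ (by positivity)] at h5
  have hk : (0 : ℝ) ≤ k := Nat.cast_nonneg k
  have hw0 : c₀ ≤ w := by nlinarith
  have e3 : (2 : ℝ) ^ k * M ≤ Real.exp (k + Real.log M) := by
    rw [Real.exp_add, Real.exp_log hM]
    gcongr
    have : (2 : ℝ) ≤ Real.exp 1 := by have := Real.add_one_le_exp 1; linarith
    calc (2 : ℝ) ^ k ≤ Real.exp 1 ^ k := by gcongr
      _ = Real.exp k := by rw [← Real.exp_nat_mul, mul_one]
  calc K * (2 ^ k * M) ^ d * Real.exp (-(c₁ * M * w))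
      ≤ K * Real.exp (k + Real.log M) ^ d * Real.exp (-(c₁ * M * w)) := by gcongr
    _ = Real.exp (Real.log K + d * (k + Real.log M) + -(c₁ * M * w)) := by
        rw [Real.exp_add (Real.log K + _), Real.exp_add (Real.log K), Real.exp_log hK,
          Real.exp_nat_mul]
    _ ≤ Real.exp (Real.log θ + -(τ * (2 * w))) := by
        rw [Real.exp_le_exp]
        have a1 : (k : ℝ) + Real.log M ≤ η * M * (k + 1) := by nlinarith
        have a2 : (d : ℝ) * (k + Real.log M) ≤ c₁ * M * w / 4 := by
          have b1 : (d : ℝ) * (k + Real.log M) ≤ d * (η * M * (k + 1)) := by gcongr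
          have b2 : (d : ℝ) * (η * M * (k + 1)) ≤ (d + 1) * (η * M * (k + 1)) := by
            gcongr; linarith
          have b3 : (d + 1) * (η * M * (k + 1)) = c₁ * M * (c₀ * (k + 1)) / 4 := by
            rw [hη]; field_simp
          have b4 : c₁ * M * (c₀ * (k + 1)) ≤ c₁ * M * w := by gcongr
          linarith
        have a3 : τ * (2 * w) ≤ c₁ * M * w / 4 := by nlinarith
        have a4 : Real.log K - Real.log θ ≤ c₁ * M * w / 4 := by
          have : M * (c₁ * c₀) ≤ c₁ * M * w := by
            have := mul_le_mul_of_nonneg_left hw0 (mul_nonneg hc₁.le hM.le)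
            linarith
          linarith
        have a5 : 0 ≤ c₁ * M * w := mul_nonneg (by positivity) (by linarith)
        linarith
    _ = θ * Real.exp (-(τ * (2 * w))) := by rw [Real.exp_add, Real.exp_log hθ]

/-- The summable weights governing the scales and the sprinkling. -/
def weight (b : ℝ) (k : ℕ) : ℝ := ((k : ℝ) + 1) ^ (-b)

theorem weight_pos (b : ℝ) (k : ℕ) : 0 < weight b k := by unfold weight; positivity

theorem weight_le_one {b : ℝ} (hb : 0 ≤ b) (k : ℕ) : weight b k ≤ 1 :=
  Real.rpow_le_one_of_one_le_of_nonpos (by linarith [(Nat.cast_nonneg k : (0 : ℝ) ≤ k)])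
    (by linarith)

theorem summable_weight {b : ℝ} (hb : 1 < b) : Summable (weight b) := by
  have := (summable_nat_add_iff 1).2 (Real.summable_nat_rpow.2 (by linarith : -b < -1))
  refine this.congr fun k => ?_
  simp [weight]

theorem weight_pow (b : ℝ) (k n : ℕ) : weight b k ^ n = weight (n * b) k := by
  unfold weight
  rw [← Real.rpow_natCast, ← Real.rpow_mul (by positivity)]
  congr 1
  ring

/-- The gaps between the boxes in the renormalization. -/
def gap (b ρ : ℝ) (M k : ℕ) : ℕ := ⌊2 ^ k * M * (ρ * weight b k)⌋₊

/-- The scales of the renormalization. -/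
def scale (b ρ : ℝ) (M : ℕ) : ℕ → ℕ
  | 0 => M
  | k + 1 => 2 * scale b ρ M k + 2 * gap b ρ M k

theorem le_scale (b ρ : ℝ) (M k : ℕ) : 2 ^ k * M ≤ scale b ρ M k := by
  induction k with
  | zero => simp [scale]
  | succ k ih => rw [scale, pow_succ]; linarith

theorem gap_le {b ρ : ℝ} (hρ : 0 ≤ ρ) (M k : ℕ) :
    (gap b ρ M k : ℝ) ≤ 2 ^ k * M * (ρ * weight b k) :=
  Nat.floor_le (by have := weight_pos b k; positivity)

theorem scale_le {b ρ : ℝ} (hρ : 0 ≤ ρ) (M k : ℕ) :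
    (scale b ρ M k : ℝ) ≤ 2 ^ k * M * (1 + ρ * ∑ j ∈ Finset.range k, weight b j) := by
  induction k with
  | zero => simp [scale]
  | succ k ih =>
    have := gap_le (b := b) hρ M k
    rw [scale, Finset.sum_range_succ]
    push_cast
    rw [pow_succ]
    linarith

section Renormalization

variable {d : ℕ} {μ : Measure ((Fin d → ℤ) → ℝ)}

/-- Multi-scale renormalization: if crossings are unlikely enough at level `h` at arbitrarily large
scales, then at any higher level their probabilities decay along the sequence `W`. -/
theorem IsGFF.renormalization (hμ : IsGFF μ) (hd : 3 ≤ d) {b : ℝ} (hb : 1 < b) {W : ℕ → ℝ}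
    (hW0 : W 0 = 1) (hW2 : ∀ k, W (k + 1) ≤ 2 * W k)
    {c₀ : ℝ} (hc₀ : 0 < c₀) (hWc : ∀ k : ℕ, c₀ * (k + 1) ≤ W k)
    {κ : ℝ} (hκ : 0 < κ) (hWκ : ∀ (k : ℕ) (M : ℝ), 1 ≤ M →
      κ * M * W k ≤ weight b k ^ 2 * (2 ^ k * M * weight b k) ^ decayExp d)
    {h h' : ℝ} (hh : h < h') {θ₀ : ℝ} (hθ₀ : 0 < θ₀) (hθ₁ : θ₀ < 1)
    (hfreq : ∃ᶠ M : ℕ in atTop, pairCount d * crossProb μ h M ≤ θ₀) :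
    ∃ (τ : ℝ) (M : ℕ) (L : ℕ → ℕ), 0 < τ ∧ 1 ≤ M ∧ (∀ k, L k ≤ 2 ^ (k + 1) * M) ∧
      ∀ k, crossProb μ h' (L k) ≤ Real.exp (-(τ * W k)) := by
  obtain ⟨C, hC, hgreen⟩ := green_decay hd
  have hdpos : (0 : ℝ) < d := by exact_mod_cast (by omega : 0 < d)
  have hΛ1 : 1 ≤ pairCount d := by
    have h1 : (1 : ℝ) ≤ 3 ^ d := one_le_pow₀ (by norm_num)
    have h2 : (1 : ℝ) ≤ 7 ^ (d - 1) := one_le_pow₀ (by norm_num)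
    have h3 : (1 : ℝ) ≤ d := by exact_mod_cast (by omega : 1 ≤ d)
    unfold pairCount
    exact one_le_mul_of_one_le_of_one_le h1 (one_le_mul_of_one_le_of_one_le h3 (by linarith))
  set Λ := pairCount d
  have hΛ : 0 < Λ := by linarith
  set A := ∑' k, weight b k with hA
  have hsum := summable_weight hb
  have hAle : ∀ k, ∑ j ∈ Finset.range k, weight b j ≤ A := fun k =>
    hsum.sum_le_tsum _ fun j _ => (weight_pos b j).le
  have hA1 : 1 ≤ A := by
    have := hAle 1
    simpa [weight] using this
  have hApos : 0 < A := by linarith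
  -- The gaps then enlarge the scales by a bounded total factor, and each is at most a quarter of
  -- its scale, as the geometric step requires.
  set ρ := 1 / (4 * A) with hρ
  have hρpos : 0 < ρ := by positivity
  have hρ4 : ρ ≤ 1 / 4 := by
    rw [hρ]
    apply one_div_le_one_div_of_le <;> linarith
  have hρA : ρ * A = 1 / 4 := by rw [hρ]; field_simp
  -- The increments `δ * weight b k` add up to exactly `h' - h`.
  set δ := (h' - h) / A with hδ
  have hδpos : 0 < δ := div_pos (by linarith) hApos
  -- Thus `θ₀ = exp(-2τ)`, the initial bound `exp(-τ(1 + W 0))`.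
  set τ := -Real.log θ₀ / 2 with hτ
  have hτpos : 0 < τ := by
    have := Real.log_neg hθ₀ hθ₁
    rw [hτ]; linarith
  set c₁ := δ ^ 2 * (ρ / 2) ^ decayExp d / (8 * C) * κ with hc₁
  have hc₁pos : 0 < c₁ := by positivity
  have hexpτ : Real.exp (-τ) < 1 := Real.exp_lt_one_iff.2 (by linarith)
  -- This is the slack `exp(-τ) - exp(-2τ)`, the room left for the decoupling error after squaring.
  set θ := (1 - Real.exp (-τ)) * Real.exp (-τ) with hθ
  have hθpos : 0 < θ := mul_pos (by linarith) (Real.exp_pos _)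
  obtain ⟨c₂, hc₂, hc₂k⟩ := exists_mul_le_two_pow_mul_rpow b
  have herr := eventually_error_le d (K := Λ ^ 2 * 4 * 8 ^ d) (τ := τ) (by positivity) hc₀ hc₁pos hθpos
  -- Every gap before rounding is then at least 2, so rounding down loses at most a factor two.
  have hlarge : ∀ᶠ M : ℕ in atTop, 2 / (c₂ * ρ) ≤ (M : ℝ) :=
    tendsto_natCast_atTop_atTop.eventually_ge_atTop _
  obtain ⟨M, hM0, hMerr, hMlarge, hM1⟩ :=
    (hfreq.and_eventually (herr.and (hlarge.and (eventually_ge_atTop 1)))).exists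
  have hM1' : (1 : ℝ) ≤ M := by exact_mod_cast hM1
  have hscale : ∀ k, (scale b ρ M k : ℝ) ≤ 2 ^ (k + 1) * M := by
    intro k
    refine (scale_le hρpos.le M k).trans ?_
    have : ρ * ∑ j ∈ Finset.range k, weight b j ≤ 1 := by
      have := mul_le_mul_of_nonneg_left (hAle k) hρpos.le
      linarith
    rw [pow_succ]
    have h1 : (0 : ℝ) ≤ 2 ^ k * M := by positivity
    nlinarith
  have hgap2 : ∀ k, 2 ≤ 2 ^ k * (M : ℝ) * (ρ * weight b k) := by
    intro k
    rw [div_le_iff₀ (by positivity)] at hMlarge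
    have h1 : c₂ ≤ 2 ^ k * weight b k := by
      refine le_trans ?_ (hc₂k k)
      nlinarith [(Nat.cast_nonneg k : (0 : ℝ) ≤ k)]
    calc (2 : ℝ) ≤ M * (c₂ * ρ) := hMlarge
      _ ≤ M * ((2 ^ k * weight b k) * ρ) := by gcongr
      _ = _ := by ring
  have hgap : ∀ k, 2 ^ k * (M : ℝ) * weight b k * (ρ / 2) ≤ gap b ρ M k := by
    intro k
    have h1 := Nat.lt_floor_add_one (2 ^ k * (M : ℝ) * (ρ * weight b k))
    have h2 := hgap2 k
    unfold gap
    linarith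
  set lev : ℕ → ℝ := fun k => h + δ * ∑ j ∈ Finset.range k, weight b j with hlev
  have hlevle : ∀ k, lev k ≤ h' := by
    intro k
    have := mul_le_mul_of_nonneg_left (hAle k) hδpos.le
    have e : δ * A = h' - h := by rw [hδ]; field_simp
    simp only [hlev]
    linarith
  -- The extra 1 in the exponent makes the induction close: squaring yields `exp(-τ(2 + 2 W k))`,
  -- and the surplus factor `exp(-τ)` gives room for the error term.
  have hmain : ∀ k, Λ * crossProb μ (lev k) (scale b ρ M k) ≤ Real.exp (-(τ * (1 + W k))) := by
    intro k
    induction k with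
    | zero =>
      simp only [hlev, scale, Finset.range_zero, Finset.sum_empty, mul_zero, add_zero, hW0]
      refine hM0.trans (le_of_eq ?_)
      rw [hτ, ← Real.exp_log hθ₀, Real.log_exp]
      congr 1
      ring
    | succ k ih =>
      set p := crossProb μ (lev k) (scale b ρ M k) with hp
      have hs1 : 1 ≤ gap b ρ M k := by
        unfold gap
        exact Nat.le_floor (by have := hgap2 k; push_cast; linarith)
      have hs4 : 4 * gap b ρ M k ≤ scale b ρ M k := by
        have h1 := gap_le (b := b) hρpos.le M k
        have h2 : ((2 ^ k * M : ℕ) : ℝ) ≤ scale b ρ M k := by exact_mod_cast le_scale b ρ M k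
        have h3 : ρ * weight b k ≤ 1 / 4 * 1 := by
          have := weight_le_one (by linarith : 0 ≤ b) k
          have := weight_pos b k
          gcongr
        have h4 : 2 ^ k * (M : ℝ) * (ρ * weight b k) ≤ 2 ^ k * M * (1 / 4 * 1) := by gcongr
        have : (4 * gap b ρ M k : ℝ) ≤ scale b ρ M k := by
          push_cast at h2
          linarith
        exact_mod_cast this
      have hstep := hμ.crossProb_step hd hC hgreen hs1 hs4 (lev k)
        (ε := δ * weight b k) (by have := weight_pos b k; positivity)
      have elev : lev k + δ * weight b k = lev (k + 1) := by
        simp only [hlev, Finset.sum_range_succ]; ring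
      rw [elev] at hstep
      -- The growth of `W` is constrained here: the exponent of the decoupling error must dominate
      -- it, which is the role of `hWκ`.
      have hexpo : c₁ * M * W k ≤
          (δ * weight b k) ^ 2 * (gap b ρ M k : ℝ) ^ decayExp d / (8 * C) := by
        have h1 := hWκ k M hM1'
        have hw := weight_pos b k
        calc c₁ * M * W k = δ ^ 2 * (ρ / 2) ^ decayExp d / (8 * C) * (κ * M * W k) := by
              rw [hc₁]; ring
          _ ≤ δ ^ 2 * (ρ / 2) ^ decayExp d / (8 * C) *
              (weight b k ^ 2 * (2 ^ k * M * weight b k) ^ decayExp d) := by gcongr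
          _ = (δ * weight b k) ^ 2 * (2 ^ k * M * weight b k * (ρ / 2)) ^ decayExp d / (8 * C) := by
              rw [mul_pow _ (ρ / 2)]; ring
          _ ≤ _ := by
              gcongr
              exact hgap k
      have h3L : (3 * (scale b ρ M k : ℝ) + 1) ≤ 8 * (2 ^ k * M) := by
        have h1 := hscale k
        have h2 : (1 : ℝ) ≤ 2 ^ k * M := one_le_mul_of_one_le_of_one_le
          (one_le_pow₀ (by norm_num)) hM1'
        rw [pow_succ] at h1
        linarith
      have herrk := hMerr k (W k) (hWc k)
      have hp0 : 0 ≤ p := measureReal_nonneg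
      have hq : (Λ * p) ^ 2 ≤ Real.exp (-(τ * (1 + W k))) ^ 2 := by gcongr
      have hE : Λ ^ 2 * (4 * (3 * (scale b ρ M k : ℝ) + 1) ^ d * Real.exp
          (-((δ * weight b k) ^ 2 * (gap b ρ M k : ℝ) ^ decayExp d / (8 * C)))) ≤
          θ * Real.exp (-(τ * (2 * W k))) := by
        refine le_trans ?_ herrk
        calc _ ≤ Λ ^ 2 * (4 * (8 * (2 ^ k * (M : ℝ))) ^ d * Real.exp (-(c₁ * M * W k))) := by
              gcongr
          _ = _ := by rw [mul_pow]; ring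
      have hstep' : Λ * crossProb μ (lev (k + 1)) (scale b ρ M (k + 1)) ≤
          (Λ * p) ^ 2 + Λ ^ 2 * (4 * (3 * (scale b ρ M k : ℝ) + 1) ^ d * Real.exp
          (-((δ * weight b k) ^ 2 * (gap b ρ M k : ℝ) ^ decayExp d / (8 * C)))) := by
        refine (mul_le_mul_of_nonneg_left hstep hΛ.le).trans (le_of_eq ?_)
        ring
      calc Λ * crossProb μ (lev (k + 1)) (scale b ρ M (k + 1))
          ≤ Real.exp (-(τ * (1 + W k))) ^ 2 + θ * Real.exp (-(τ * (2 * W k))) := by linarith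
        _ = Real.exp (-τ) * Real.exp (-τ) * Real.exp (-(τ * (2 * W k))) +
            θ * Real.exp (-(τ * (2 * W k))) := by
            congr 1
            rw [← Real.exp_nat_mul, ← Real.exp_add, ← Real.exp_add]
            congr 1
            push_cast
            ring
        _ = Real.exp (-(τ * (1 + 2 * W k))) := by
            have : -(τ * (1 + 2 * W k)) = -τ + -(τ * (2 * W k)) := by ring
            rw [this, Real.exp_add, hθ]
            ring
        _ ≤ Real.exp (-(τ * (1 + W (k + 1)))) := by
            have := hW2 k
            gcongr
  refine ⟨τ, M, scale b ρ M, hτpos, hM1, fun k => ?_, fun k => ?_⟩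
  · exact_mod_cast hscale k
  · have h1 := hμ.crossProb_anti (hlevle k) (scale b ρ M k)
    have h2 : 0 ≤ crossProb μ (lev k) (scale b ρ M k) := measureReal_nonneg
    have h3 := hmain k
    have h4 : Real.exp (-(τ * (1 + W k))) ≤ Real.exp (-(τ * W k)) := by gcongr; linarith
    nlinarith

end Renormalization


/-! ### Cluster exploration and percolation at negative levels -/

section Exploration

variable {d : ℕ}

theorem adj_add_single (w : Fin d → ℤ) (i : Fin d) : (lattice d).Adj w (w + Pi.single i 1) := by
  have : ∀ j, |w j - (w + Pi.single i 1 : Fin d → ℤ) j| = if j = i then 1 else 0 := by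
    intro j
    by_cases h : j = i
    · subst h; simp
    · simp [h]
  change ∑ j, |w j - (w + Pi.single i 1 : Fin d → ℤ) j| = 1
  simp only [this, Finset.sum_ite_eq', Finset.mem_univ, if_true]

theorem adj_sub_single (w : Fin d → ℤ) (i : Fin d) : (lattice d).Adj w (w - Pi.single i 1) := by
  have := (adj_add_single (w - Pi.single i 1) i).symm
  simpa using this

open Classical in
/-- The sites of `B` connected to `R` inside `S ∩ B`. -/
def cluster (B R : Finset (Fin d → ℤ)) (S : Set (Fin d → ℤ)) : Finset (Fin d → ℤ) :=
  B.filter fun z => ∃ v ∈ R, Joined (S ∩ B) z v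

open Classical in
/-- The sites revealed by the exploration of a cluster `T` from `R` inside `B`. -/
def explored (B R T : Finset (Fin d → ℤ)) : Finset (Fin d → ℤ) :=
  R ∪ T ∪ B.filter fun z => ∃ w ∈ T, (lattice d).Adj z w

variable {B R : Finset (Fin d → ℤ)}

theorem mem_cluster {S : Set (Fin d → ℤ)} {z : Fin d → ℤ} :
    z ∈ cluster B R S ↔ ∃ v ∈ R, Joined (S ∩ B) z v := by
  simp only [cluster, Finset.mem_filter, and_iff_right_iff_imp]
  rintro ⟨v, -, hj⟩
  exact hj.left_mem.2

theorem mem_explored {T : Finset (Fin d → ℤ)} {z : Fin d → ℤ} :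
    z ∈ explored B R T ↔ z ∈ R ∨ z ∈ T ∨ z ∈ B ∧ ∃ w ∈ T, (lattice d).Adj z w := by
  simp [explored]

theorem cluster_subset (S : Set (Fin d → ℤ)) : cluster B R S ⊆ B := fun _ hz => by
  obtain ⟨v, -, hj⟩ := mem_cluster.1 hz
  exact hj.left_mem.2

theorem mem_cluster_of_mem (hR : R ⊆ B) {S : Set (Fin d → ℤ)} {z : Fin d → ℤ} (hz : z ∈ R)
    (hS : z ∈ S) : z ∈ cluster B R S :=
  mem_cluster.2 ⟨z, hz, Joined.refl ⟨hS, hR hz⟩⟩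

theorem mem_cluster_of_adj {S : Set (Fin d → ℤ)} {z w : Fin d → ℤ} (hz : z ∈ B) (hS : z ∈ S)
    (hw : w ∈ cluster B R S) (hadj : (lattice d).Adj z w) : z ∈ cluster B R S := by
  obtain ⟨v, hv, hj⟩ := mem_cluster.1 hw
  exact mem_cluster.2 ⟨v, hv, hj.cons ⟨hS, hz⟩ hadj⟩

theorem notMem_of_mem_explored (hR : R ⊆ B) {S : Set (Fin d → ℤ)} {z : Fin d → ℤ}
    (hz : z ∈ explored B R (cluster B R S)) (hzT : z ∉ cluster B R S) : z ∉ S := by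
  intro hS
  rcases mem_explored.1 hz with h | h | ⟨hB, w, hw, hadj⟩
  · exact hzT (mem_cluster_of_mem hR h hS)
  · exact hzT h
  · exact hzT (mem_cluster_of_adj hB hS hw hadj)

/-- Followed back from `R`, a path can only enter the cluster through sites adjacent to it, and all
of these in `B` have been revealed. Agreement on the revealed sites therefore fixes the cluster. -/
theorem cluster_congr (hR : R ⊆ B) {S S' : Set (Fin d → ℤ)}
    (h : S ∩ explored B R (cluster B R S) = S' ∩ explored B R (cluster B R S)) :
    cluster B R S' = cluster B R S := by
  have hSS : ∀ z ∈ explored B R (cluster B R S), (z ∈ S ↔ z ∈ S') := fun z hz => by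
    have := Set.ext_iff.1 h z
    simpa [hz] using this
  apply Finset.Subset.antisymm
  · intro z hz
    obtain ⟨v, hv, w, hw⟩ := mem_cluster.1 hz
    clear hz
    induction w with
    | nil =>
      exact mem_cluster_of_mem hR hv ((hSS _ (mem_explored.2 (Or.inl hv))).2 (hw _ (by simp)).1)
    | @cons a b c hab p ih =>
      have hb := ih hv fun z hz => hw z (by simp [hz])
      have ha := hw a (by simp)
      exact mem_cluster_of_adj ha.2
        ((hSS _ (mem_explored.2 (Or.inr (Or.inr ⟨ha.2, b, hb, hab⟩)))).2 ha.1) hb hab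
  · intro z hz
    obtain ⟨v, hv, w, hw⟩ := mem_cluster.1 hz
    clear hz
    refine mem_cluster.2 ⟨v, hv, w, fun y hy => ?_⟩
    have hyS := hw y hy
    have hyT : y ∈ cluster B R S := mem_cluster.2 ⟨v, hv, w.dropUntil y hy, fun x hx =>
      hw x (w.support_dropUntil_subset_support hy hx)⟩
    exact ⟨(hSS y (mem_explored.2 (Or.inr (Or.inl hyT)))).1 hyS.1, hyS.2⟩

theorem dependsOn_cluster (hR : R ⊆ B) (T : Finset (Fin d → ℤ)) :
    DependsOn {S | cluster B R S = T} (explored B R T) := by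
  have key : ∀ S S' : Set (Fin d → ℤ), S ∩ explored B R T = S' ∩ explored B R T →
      cluster B R S = T → cluster B R S' = T := by
    rintro S S' h rfl
    exact cluster_congr hR h
  exact fun S S' h => ⟨key S S' h, key S' S h.symm⟩

variable {μ : Measure ((Fin d → ℤ) → ℝ)}

theorem IsGFF.integrable_eval (hμ : IsGFF μ) (x : Fin d → ℤ) :
    Integrable (fun φ : (Fin d → ℤ) → ℝ => φ x) μ :=
  (hμ.gaussian.hasGaussianLaw_eval x).integrable

/-- The harmonic average over `K` computes expectations on events depending on `K` only. -/
theorem IsGFF.setIntegral_eq (hμ : IsGFF μ) {K : Finset (Fin d → ℤ)}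
    {a : (Fin d → ℤ) → (Fin d → ℤ) → ℝ}
    (ha : ∀ x, ∀ z ∈ K, ∑ y ∈ K, a x y * green d y z = green d x z)
    {E : Set (Set (Fin d → ℤ))} (hE : DependsOn E K) (h : ℝ) (x : Fin d → ℤ) :
    ∫ φ in {φ | excursionSet h φ ∈ E}, φ x ∂μ =
      ∑ y ∈ K, a x y * ∫ φ in {φ | excursionSet h φ ∈ E}, φ y ∂μ := by
  have := hμ.isProbabilityMeasure
  have hm := measurableSet_localEvent E K h
  have hind1 : Measurable ((localEvent E K h).indicator fun _ => (1 : ℝ)) :=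
    measurable_const.indicator hm
  have hev : Measurable fun φ : (Fin d → ℤ) → ℝ => φ x := measurable_pi_apply x
  have hind := (hμ.indepFun_sub_lin K a ha).comp
    (φ := (localEvent E K h).indicator fun _ => (1 : ℝ)) (ψ := fun ψ => ψ x)
    hind1 hev
  have hmeas : Measurable fun φ : (Fin d → ℤ) → ℝ => φ x - lin K (a x) φ :=
    (measurable_pi_apply x).sub (measurable_lin _ _)
  have h0 := hind.integral_fun_mul_eq_mul_integral
    (hind1.comp (by fun_prop)).aestronglyMeasurable
    hmeas.aestronglyMeasurable
  have hlin : Integrable (lin K (a x)) μ := (hμ.hasGaussianLaw_lin K (a x)).integrable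
  have hzero : ∫ φ : (Fin d → ℤ) → ℝ, φ x - lin K (a x) φ ∂μ = 0 := by
    rw [integral_sub (hμ.integrable_eval x) hlin, hμ.centered, hμ.integral_lin, sub_zero]
  simp only [Function.comp_def] at h0
  rw [hzero, mul_zero] at h0
  have hset : ∀ φ : (Fin d → ℤ) → ℝ, (localEvent E K h).indicator (fun _ => (1 : ℝ))
      (fun k : K => φ k) * (φ x - lin K (a x) φ) =
      {φ | excursionSet h φ ∈ E}.indicator (fun φ => φ x - lin K (a x) φ) φ := by
    intro φ
    by_cases hφ : excursionSet h φ ∈ E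
    · rw [Set.indicator_of_mem ((hE.mem_iff h φ).1 hφ), one_mul, Set.indicator_of_mem]
      exact hφ
    · rw [Set.indicator_of_notMem (fun hc => hφ ((hE.mem_iff h φ).2 hc)), zero_mul,
        Set.indicator_of_notMem]
      exact hφ
  simp only [hset] at h0
  rw [integral_indicator (hE.measurableSet h),
    integral_sub (hμ.integrable_eval x).integrableOn hlin.integrableOn] at h0
  have e : ∫ φ in {φ | excursionSet h φ ∈ E}, lin K (a x) φ ∂μ =
      ∑ y ∈ K, a x y * ∫ φ in {φ | excursionSet h φ ∈ E}, φ y ∂μ := by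
    unfold lin
    rw [integral_finsetSum _ fun y _ => ((hμ.integrable_eval y).const_mul (a x y)).integrableOn]
    simp only [integral_const_mul]
  linarith

/-- If the exploration of the cluster of `R` does not reach the origin, the field there has mean
at most `h`. -/
theorem IsGFF.setIntegral_cluster_le (hμ : IsGFF μ) (hd : 3 ≤ d) (hR : R ⊆ B)
    (hB : ∀ w ∈ B, w ∉ R → ∀ i, w + Pi.single i 1 ∈ B ∧ w - Pi.single i 1 ∈ B)
    (h0 : 0 ∈ B) {T : Finset (Fin d → ℤ)} (hT : 0 ∉ T) (h : ℝ) :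
    ∫ φ in {φ | cluster B R (excursionSet h φ) = T}, φ 0 ∂μ ≤
      h * μ.real {φ | cluster B R (excursionSet h φ) = T} := by
  classical
  have := hμ.isProbabilityMeasure
  set K := explored B R T
  set A := {φ : (Fin d → ℤ) → ℝ | cluster B R (excursionSet h φ) = T} with hA
  choose a ha0 _ ha2 ha3 using exists_hitting_weights K hd
  have hdep := dependsOn_cluster hR T
  have hmeas : MeasurableSet A := hdep.measurableSet h
  -- A walk from the origin cannot enter `T` without first hitting a revealed neighbour of it, nor
  -- leave `B` without first hitting `R`. The hitting distribution thus has full mass on revealed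
  -- sites outside the cluster, where the field is below `h`.
  obtain ⟨haW, hasum⟩ := ha3 0 (B \ T) (fun w hw hwK i => by
    rw [Finset.mem_sdiff] at hw
    have hwR : w ∉ R := fun hc => hwK (mem_explored.2 (Or.inl hc))
    have hnot : ∀ z, (lattice d).Adj w z → z ∉ T := fun z hz hzT =>
      hwK (mem_explored.2 (Or.inr (Or.inr ⟨hw.1, z, hzT, hz⟩)))
    simp only [Finset.mem_sdiff]
    exact ⟨⟨(hB w hw.1 hwR i).1, hnot _ (adj_add_single w i)⟩,
      ⟨(hB w hw.1 hwR i).2, hnot _ (adj_sub_single w i)⟩⟩) (Finset.mem_sdiff.2 ⟨h0, hT⟩)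
  have e := hμ.setIntegral_eq ha2 hdep h 0
  change ∫ φ in A, φ 0 ∂μ = ∑ y ∈ K, a 0 y * ∫ φ in A, φ y ∂μ at e
  rw [e]
  have hle : ∀ y ∈ K, a 0 y * ∫ φ in A, φ y ∂μ ≤ a 0 y * (h * μ.real A) := by
    intro y hy
    by_cases hyW : y ∈ B \ T
    · refine mul_le_mul_of_nonneg_left ?_ (ha0 0 y)
      have hyT := (Finset.mem_sdiff.1 hyW).2
      calc ∫ φ in A, φ y ∂μ ≤ ∫ _ in A, h ∂μ := by
            refine setIntegral_mono_on (hμ.integrable_eval y).integrableOn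
              (integrable_const h).integrableOn hmeas fun φ hφ => ?_
            have hφ' : cluster B R (excursionSet h φ) = T := hφ
            have := notMem_of_mem_explored hR (S := excursionSet h φ) (z := y)
              (by rw [hφ']; exact hy) (by rw [hφ']; exact hyT)
            exact (not_le.1 this).le
        _ = h * μ.real A := by rw [setIntegral_const, smul_eq_mul, mul_comm]
    · rw [haW y hyW, zero_mul, zero_mul]
  refine (Finset.sum_le_sum hle).trans (le_of_eq ?_)
  rw [← Finset.sum_mul, hasum, one_mul]

/-- At a negative level, the origin is connected to the boundary of any finite box with probability
bounded below. -/
theorem IsGFF.le_measureReal_cluster (hμ : IsGFF μ) (hd : 3 ≤ d) (hR : R ⊆ B)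
    (hB : ∀ w ∈ B, w ∉ R → ∀ i, w + Pi.single i 1 ∈ B ∧ w - Pi.single i 1 ∈ B)
    (h0 : 0 ∈ B) {h : ℝ} {s : ℝ} (hs : 0 < s) :
    0 ≤ s / 2 * μ.real {φ | 0 ∈ cluster B R (excursionSet h φ)} + green d 0 0 / (2 * s) +
      h * (1 - μ.real {φ | 0 ∈ cluster B R (excursionSet h φ)}) := by
  classical
  have := hμ.isProbabilityMeasure
  set A := {φ : (Fin d → ℤ) → ℝ | 0 ∈ cluster B R (excursionSet h φ)} with hA
  set E : Finset (Fin d → ℤ) → Set ((Fin d → ℤ) → ℝ) := fun T =>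
    {φ | cluster B R (excursionSet h φ) = T} with hE
  set I := B.powerset.filter fun T => (0 : Fin d → ℤ) ∉ T with hI
  have hEm : ∀ T, MeasurableSet (E T) := fun T => (dependsOn_cluster hR T).measurableSet h
  have hcompl : Aᶜ = ⋃ T ∈ I, E T := by
    ext φ
    simp only [hA, hE, hI, Set.mem_compl_iff, Set.mem_ofPred_eq, Set.mem_iUnion, Finset.mem_filter,
      Finset.mem_powerset, exists_prop, exists_eq_right']
    exact ⟨fun hc => ⟨cluster_subset _, hc⟩, fun hc => hc.2⟩
  have hAm : MeasurableSet A := by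
    rw [← MeasurableSet.compl_iff, hcompl]
    exact Finset.measurableSet_biUnion _ fun T _ => hEm T
  have hdisj : Set.PairwiseDisjoint (I : Set (Finset (Fin d → ℤ))) E := by
    intro T _ T' _ hne
    rw [Function.onFun, Set.disjoint_left]
    intro φ h1 h2
    exact hne ((h1 : cluster B R (excursionSet h φ) = T).symm.trans h2)
  have hint := hμ.integrable_eval 0
  -- The centred field splits its zero mean between `A` and its complement. The complement is a
  -- finite disjoint union over the clusters missing the origin, each contributing at most `h` times
  -- its probability.
  have hsplit := integral_add_compl hAm hint
  rw [hμ.centered] at hsplit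
  have hc : ∫ φ in Aᶜ, φ 0 ∂μ ≤ h * (1 - μ.real A) := by
    rw [← probReal_compl_eq_one_sub hAm, hcompl,
      integral_biUnion_finset _ (fun T _ => hEm T) hdisj (fun T _ => hint.integrableOn),
      measureReal_biUnion_finset hdisj (fun T _ => hEm T), Finset.mul_sum]
    exact Finset.sum_le_sum fun T hT =>
      hμ.setIntegral_cluster_le hd hR hB h0 (Finset.mem_filter.1 hT).2 h
  have hsq : Integrable (fun φ : (Fin d → ℤ) → ℝ => φ 0 * φ 0) μ := by
    simpa only [sq] using (hμ.memLp 0).integrable_sq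
  -- Expanding `(φ 0 - s) ^ 2 ≥ 0` gives `φ 0 ≤ s/2 + φ 0 ^ 2 / (2s)`, which controls the mean on
  -- `A` through the variance.
  have hA' : ∫ φ in A, φ 0 ∂μ ≤ s / 2 * μ.real A + green d 0 0 / (2 * s) := by
    calc ∫ φ in A, φ 0 ∂μ ≤ ∫ φ in A, (s / 2 + 1 / (2 * s) * (φ 0 * φ 0)) ∂μ := by
          refine setIntegral_mono_on hint.integrableOn
            ((integrable_const _).add (hsq.const_mul _)).integrableOn hAm fun φ _ => ?_
          have : s / 2 + 1 / (2 * s) * (φ 0 * φ 0) - φ 0 = (φ 0 - s) ^ 2 / (2 * s) := by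
            field_simp; ring
          have : 0 ≤ (φ 0 - s) ^ 2 / (2 * s) := by positivity
          linarith
      _ = s / 2 * μ.real A + 1 / (2 * s) * ∫ φ in A, φ 0 * φ 0 ∂μ := by
          rw [integral_add (integrable_const _).integrableOn (hsq.const_mul _).integrableOn,
            setIntegral_const, smul_eq_mul, integral_const_mul, mul_comm (s / 2)]
      _ ≤ s / 2 * μ.real A + 1 / (2 * s) * ∫ φ, φ 0 * φ 0 ∂μ := by
          gcongr ?_ + 1 / (2 * s) * ?_
          · exact le_rfl
          · exact setIntegral_le_integral hsq (Eventually.of_forall fun φ => mul_self_nonneg _)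
      _ = _ := by rw [hμ.covariance]; ring
  linarith

/-- With `s` so large that the variance term is at most `-h/2`, the inequality for the cluster of
the box boundary bounds its probability below, uniformly in `L`. -/
theorem IsGFF.exists_le_measureReal_connects (hμ : IsGFF μ) (hd : 3 ≤ d) {h : ℝ} (hh : h < 0) :
    ∃ c : ℝ, 0 < c ∧ ∀ L : ℕ, c ≤ μ.real (connects h (supBall d L) (supSphere d (2 * L))) := by
  classical
  have := hμ.isProbabilityMeasure
  have hg : 0 ≤ green d 0 0 := green_nonneg 0 0
  set s := green d 0 0 / (-h) + 1 with hs
  have hnh : 0 < -h := by linarith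
  have hs0 : 0 < s := by positivity
  refine ⟨(-h / 2) / (s / 2 - h), div_pos (by linarith) (by linarith), fun L => ?_⟩
  set B : Finset (Fin d → ℤ) := Finset.Icc (fun _ => -((2 * L : ℕ) : ℤ)) (fun _ => ((2 * L : ℕ) : ℤ))
    with hBdef
  have hBmem : ∀ z, z ∈ B ↔ ∀ i, |z i| ≤ ((2 * L : ℕ) : ℤ) := by
    intro z
    simp only [hBdef, Finset.mem_Icc, Pi.le_def, ← forall_and, abs_le]
  set R := B.filter fun z => ∃ i, |z i| = ((2 * L : ℕ) : ℤ) with hRdef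
  have hclosed : ∀ w ∈ B, w ∉ R → ∀ i, w + Pi.single i 1 ∈ B ∧ w - Pi.single i 1 ∈ B := by
    intro w hw hwR i
    have hlt : ∀ j, |w j| < ((2 * L : ℕ) : ℤ) := fun j => lt_of_le_of_ne ((hBmem w).1 hw j)
      fun hc => hwR (Finset.mem_filter.2 ⟨hw, j, hc⟩)
    have hadj : ∀ z, (lattice d).Adj w z → z ∈ B := by
      intro z hz
      rw [hBmem]
      intro j
      have h1 := abs_le.1 (abs_sub_le_of_adj hz j)
      have h2 := abs_lt.1 (hlt j)
      rw [abs_le]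
      omega
    exact ⟨hadj _ (adj_add_single w i), hadj _ (adj_sub_single w i)⟩
  have key := hμ.le_measureReal_cluster hd (B := B) (R := R) (Finset.filter_subset _ _) hclosed
    ((hBmem 0).2 fun i => by simp) (h := h) hs0
  have hsub : {φ : (Fin d → ℤ) → ℝ | 0 ∈ cluster B R (excursionSet h φ)} ⊆
      connects h (supBall d L) (supSphere d (2 * L)) := by
    intro φ hφ
    obtain ⟨v, hv, hj⟩ := mem_cluster.1 hφ
    obtain ⟨hvB, hvR⟩ := Finset.mem_filter.1 hv
    exact ⟨0, fun i => by simp, v, ⟨(hBmem v).1 hvB, hvR⟩, hj.mono Set.inter_subset_left⟩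
  refine le_trans ?_ (measureReal_mono hsub)
  rw [div_le_iff₀ (by linarith)]
  have : green d 0 0 / (2 * s) ≤ -h / 2 := by
    rw [div_le_div_iff₀ (by positivity) (by norm_num)]
    have : -h * s = green d 0 0 + -h := by
      rw [hs, mul_add, mul_one, mul_div_cancel₀ _ hnh.ne']
    nlinarith
  nlinarith

end Exploration


/-! ### Decay of connections and characterization of the critical level -/

section Decay

variable {d : ℕ} {μ : Measure ((Fin d → ℤ) → ℝ)}

/-- The event that `u` is connected above level `h` to a site at sup-distance at least `r`. -/
def farEvent (h : ℝ) (u : Fin d → ℤ) (r : ℕ) : Set ((Fin d → ℤ) → ℝ) :=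
  {φ | ∃ v, (∃ i, (r : ℤ) ≤ |v i - u i|) ∧ Joined (excursionSet h φ) u v}

theorem IsGFF.measureReal_farEvent_le (hμ : IsGFF μ) (h : ℝ) (u : Fin d → ℤ) {L r : ℕ}
    (hr : 2 * L < r) : μ.real (farEvent h u r) ≤ crossProb μ h L := by
  have := hμ.isProbabilityMeasure
  refine le_trans (measureReal_mono ?_) (hμ.measureReal_crossing_le h u L)
  rintro φ ⟨v, ⟨i, hi⟩, hj⟩
  refine mem_crossing (by positivity) (fun j => ⟨le_rfl, by omega⟩) (Or.inl ?_) hj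
  rw [Finset.mem_coe, mem_dom]
  intro hc
  have h1 := hc i
  rcases le_abs.1 hi with h2 | h2 <;> omega

theorem IsGFF.exists_farEvent_le (hμ : IsGFF μ) (hd : 3 ≤ d) {b : ℝ} (hb : 1 < b) {W : ℕ → ℝ}
    (hW0 : W 0 = 1) (hW2 : ∀ k, W (k + 1) ≤ 2 * W k)
    {c₀ : ℝ} (hc₀ : 0 < c₀) (hWc : ∀ k : ℕ, c₀ * (k + 1) ≤ W k)
    {κ : ℝ} (hκ : 0 < κ) (hWκ : ∀ (k : ℕ) (M : ℝ), 1 ≤ M →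
      κ * M * W k ≤ weight b k ^ 2 * (2 ^ k * M * weight b k) ^ decayExp d)
    {h h' : ℝ} (hh : h < h') {θ₀ : ℝ} (hθ₀ : 0 < θ₀) (hθ₁ : θ₀ < 1)
    (hfreq : ∃ᶠ M : ℕ in atTop, pairCount d * crossProb μ h M ≤ θ₀) :
    ∃ (τ : ℝ) (M : ℕ), 0 < τ ∧ 1 ≤ M ∧ ∀ r : ℕ, 4 * M < r →
      ∃ k : ℕ, r ≤ 2 ^ (k + 3) * M ∧ 2 ^ (k + 2) * M < r ∧
        ∀ u : Fin d → ℤ, μ.real (farEvent h' u r) ≤ Real.exp (-(τ * W k)) := by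
  obtain ⟨τ, M, L, hτ, hM, hL, hp⟩ := hμ.renormalization hd hb hW0 hW2 hc₀ hWc hκ hWκ hh hθ₀ hθ₁ hfreq
  refine ⟨τ, M, hτ, hM, fun r hr => ?_⟩
  have hex : ∃ k : ℕ, r ≤ 2 ^ (k + 3) * M := by
    refine ⟨r, ?_⟩
    have h1 : r < 2 ^ r := Nat.lt_two_pow_self
    have h2 : 2 ^ r ≤ 2 ^ (r + 3) := Nat.pow_le_pow_right (by norm_num) (by omega)
    nlinarith
  -- The lower bound on `r` lets the event force a crossing at scale `L k`; the upper bound turns `W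
  -- k` into a function of `r`.
  obtain ⟨k, hk, hmin⟩ : ∃ k : ℕ, r ≤ 2 ^ (k + 3) * M ∧ 2 ^ (k + 2) * M < r := by
    classical
    refine ⟨Nat.find hex, Nat.find_spec hex, ?_⟩
    rcases Nat.eq_zero_or_pos (Nat.find hex) with h0 | hpos
    · rw [h0]; omega
    · have h1 := Nat.find_min hex (Nat.sub_lt hpos one_pos)
      rw [show Nat.find hex - 1 + 3 = Nat.find hex + 2 by omega] at h1
      omega
  refine ⟨k, hk, hmin, fun u => (hμ.measureReal_farEvent_le h' u ?_).trans (hp k)⟩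
  have h1 := hL k
  rw [pow_succ] at hmin
  linarith

/-- Exponential decay of connection probabilities in dimension at least four. -/
theorem IsGFF.farEvent_le_exp (hμ : IsGFF μ) (hd : 4 ≤ d)
    {h h' : ℝ} (hh : h < h') {θ₀ : ℝ} (hθ₀ : 0 < θ₀) (hθ₁ : θ₀ < 1)
    (hfreq : ∃ᶠ M : ℕ in atTop, pairCount d * crossProb μ h M ≤ θ₀) :
    ∃ (c : ℝ) (r₀ : ℕ), 0 < c ∧ ∀ r : ℕ, r₀ < r → ∀ u : Fin d → ℤ,
      μ.real (farEvent h' u r) ≤ Real.exp (-(c * r)) := by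
  obtain ⟨κ, hκ, hκk⟩ := exists_mul_le_two_pow_mul_rpow 8
  obtain ⟨τ, M, hτ, hM, hfar⟩ := hμ.exists_farEvent_le (by omega) (b := 2) (by norm_num)
    (W := fun k => 2 ^ k) (by norm_num) (fun k => by rw [pow_succ]; linarith) (c₀ := 1) one_pos
    (fun k => by
      have : k + 1 ≤ 2 ^ k := Nat.lt_two_pow_self
      rw [one_mul]; exact_mod_cast this) hκ (fun k M hM => by
      rw [decayExp, if_neg (by omega)]
      have h1 : κ ≤ 2 ^ k * weight 8 k := by
        refine le_trans ?_ (hκk k)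
        nlinarith [(Nat.cast_nonneg k : (0 : ℝ) ≤ k)]
      -- With Green exponent 2, the decoupling exponent is of order `4^k M^2 (k+1)^(-8)`, so the
      -- full rate `W k = 2^k` is allowed.
      have h2 : weight 2 k ^ 4 = weight 8 k := by rw [weight_pow]; norm_num
      have h3 : weight 2 k ^ 2 * (2 ^ k * M * weight 2 k) ^ 2 =
          M * (2 ^ k * weight 8 k) * (M * 2 ^ k) := by rw [← h2]; ring
      rw [h3]
      have h4 : (0 : ℝ) < M * 2 ^ k := by positivity
      calc κ * M * 2 ^ k = 1 * κ * (M * 2 ^ k) := by ring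
        _ ≤ M * (2 ^ k * weight 8 k) * (M * 2 ^ k) := by gcongr) hh hθ₀ hθ₁ hfreq
  have hM' : (0 : ℝ) < M := by exact_mod_cast hM
  refine ⟨τ / (8 * M), 4 * M, by positivity, fun r hr u => ?_⟩
  obtain ⟨k, hk, -, hle⟩ := hfar r hr
  refine (hle u).trans ?_
  rw [Real.exp_le_exp, neg_le_neg_iff, div_mul_eq_mul_div, div_le_iff₀ (by positivity)]
  have : (r : ℝ) ≤ 2 ^ (k + 3) * M := by exact_mod_cast hk
  rw [pow_add] at this
  nlinarith

/-- Stretched exponential decay of connection probabilities in all dimensions at least three. -/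
theorem IsGFF.farEvent_le_exp_div_log (hμ : IsGFF μ) (hd : 3 ≤ d) {b : ℝ} (hb : 1 < b)
    {h h' : ℝ} (hh : h < h') {θ₀ : ℝ} (hθ₀ : 0 < θ₀) (hθ₁ : θ₀ < 1)
    (hfreq : ∃ᶠ M : ℕ in atTop, pairCount d * crossProb μ h M ≤ θ₀) :
    ∃ (c : ℝ) (r₀ : ℕ), 0 < c ∧ 1 ≤ r₀ ∧ ∀ r : ℕ, r₀ < r → ∀ u : Fin d → ℤ,
      μ.real (farEvent h' u r) ≤ Real.exp (-(c * (r / Real.log r ^ (3 * b)))) := by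
  obtain ⟨c₀, hc₀, hck⟩ := exists_mul_le_two_pow_mul_rpow (3 * b)
  obtain ⟨c₁, hc₁, hck₁⟩ := exists_mul_le_two_pow_mul_rpow b
  have hκ : 0 < min 1 c₁ := lt_min one_pos hc₁
  obtain ⟨τ, M, hτ, hM, hfar⟩ := hμ.exists_farEvent_le hd hb
    (W := fun k => 2 ^ k * weight (3 * b) k) (by simp [weight]) (fun k => by
      have : weight (3 * b) (k + 1) ≤ weight (3 * b) k := by
        unfold weight
        apply Real.rpow_le_rpow_of_nonpos (by positivity)
        · push_cast; linarith
        · linarith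
      calc (2 : ℝ) ^ (k + 1) * weight (3 * b) (k + 1) ≤ 2 ^ (k + 1) * weight (3 * b) k := by gcongr
        _ = 2 * (2 ^ k * weight (3 * b) k) := by ring) hc₀ hck hκ (fun k M hM => by
      -- Two weights come from the squared sprinkling and one from the gap, whence `3b`. For Green
      -- exponent 2 there is an additional factor `2^k M * weight b k`, bounded below by `c₁`.
      have h3 : weight b k ^ 3 = weight (3 * b) k := by rw [weight_pow]; norm_num
      have hw := weight_pos b k
      have h1 : c₁ ≤ 2 ^ k * weight b k := by
        refine le_trans ?_ (hck₁ k)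
        nlinarith [(Nat.cast_nonneg k : (0 : ℝ) ≤ k)]
      rw [← h3]
      unfold decayExp
      split_ifs
      · calc min 1 c₁ * M * (2 ^ k * weight b k ^ 3) ≤ 1 * M * (2 ^ k * weight b k ^ 3) := by
              gcongr; exact min_le_left _ _
          _ = _ := by ring
      · calc min 1 c₁ * M * (2 ^ k * weight b k ^ 3) ≤
              (2 ^ k * weight b k * 1) * M * (2 ^ k * weight b k ^ 3) := by
              gcongr; rw [mul_one]; exact (min_le_right _ _).trans h1
          _ ≤ (2 ^ k * weight b k * M) * M * (2 ^ k * weight b k ^ 3) := by gcongr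
          _ = _ := by ring) hh hθ₀ hθ₁ hfreq
  have hM' : (0 : ℝ) < M := by exact_mod_cast hM
  refine ⟨τ * 2 ^ (-(3 * b)) / (8 * M), 4 * M, by positivity, by omega, fun r hr u => ?_⟩
  obtain ⟨k, hk, hk2, hle⟩ := hfar r hr
  refine (hle u).trans ?_
  rw [Real.exp_le_exp, neg_le_neg_iff]
  have h1 : (r : ℝ) ≤ 2 ^ (k + 3) * M := by exact_mod_cast hk
  rw [pow_add] at h1
  have hr1 : (1 : ℝ) < r := by exact_mod_cast (by omega : 1 < r)
  have hlog : 0 < Real.log r := Real.log_pos hr1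
  have hk1 : (k : ℝ) + 1 ≤ 2 * Real.log r := by
    have h2 : (2 : ℝ) ^ (k + 1) ≤ r := by
      have h3 : 2 ^ (k + 1) ≤ 2 ^ (k + 2) * M := by
        have : 2 ^ (k + 2) = 2 * 2 ^ (k + 1) := by ring
        nlinarith [Nat.one_le_two_pow (n := k + 1)]
      exact_mod_cast (h3.trans hk2.le)
    have h4 := Real.log_le_log (by positivity) h2
    rw [Real.log_pow] at h4
    have h5 := Real.log_two_gt_d9
    push_cast at h4
    nlinarith [(Nat.cast_nonneg k : (0 : ℝ) ≤ k)]
  have hw : 2 ^ (-(3 * b)) * Real.log r ^ (-(3 * b)) ≤ weight (3 * b) k := by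
    rw [← Real.mul_rpow (by norm_num) hlog.le]
    unfold weight
    exact Real.rpow_le_rpow_of_nonpos (by positivity) hk1 (by linarith)
  have hlogp : 0 < Real.log r ^ (-(3 * b)) := Real.rpow_pos_of_pos hlog _
  calc τ * 2 ^ (-(3 * b)) / (8 * M) * (r / Real.log r ^ (3 * b))
      = τ * (r / (8 * M) * (2 ^ (-(3 * b)) * Real.log r ^ (-(3 * b)))) := by
        rw [Real.rpow_neg hlog.le]
        field_simp
    _ ≤ τ * (2 ^ k * weight (3 * b) k) := by
        gcongr
        rw [div_le_iff₀ (by positivity)]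
        linarith

/-- The defining property of the levels whose infimum is `h_**`. -/
def PolyDecay (μ : Measure ((Fin d → ℤ) → ℝ)) (h : ℝ) : Prop :=
  ∃ α : ℝ, 0 < α ∧
    Tendsto (fun L : ℕ => (L : ℝ) ^ α * μ.real (connects h (supBall d L) (supSphere d (2 * L))))
      atTop (𝓝 0)

/-- Translation by `-L` turns `[0, 2L]^d` into `B(0, L)` and its domain into `B(0, 3L)`; a path to
the boundary of the latter meets `S(0, 2L)`. -/
theorem IsGFF.crossProb_two_mul_le (hμ : IsGFF μ) (h : ℝ) {L : ℕ} (hL : 1 ≤ L) :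
    crossProb μ h (2 * L) ≤ μ.real (connects h (supBall d L) (supSphere d (2 * L))) := by
  have := hμ.isProbabilityMeasure
  rw [crossProb, ← hμ.measureReal_translate (dependsOn_crossing 0 ((2 * L : ℕ) : ℤ)) h
    (fun _ => -(L : ℤ))]
  refine measureReal_mono ?_
  rintro φ ⟨u, hu, v, hv, hj⟩
  rw [dom, Finset.coe_Icc] at hv
  obtain ⟨-, i, hi⟩ := innerBoundary_Icc hv
  have hj' := ((hj.mono Set.inter_subset_left).translate (fun _ => (L : ℤ))).mono
    (T := excursionSet h φ) (fun z hz => by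
      have e : (z + (fun _ => (L : ℤ))) + (fun _ => -(L : ℤ)) = z := by ext i; simp
      change h ≤ φ ((z + (fun _ => (L : ℤ))) + (fun _ => -(L : ℤ))) at hz
      rwa [e] at hz)
  simp only [Pi.zero_apply] at hu hi
  obtain ⟨z, hz, hjz⟩ := hj'.exists_innerBoundary
    (K := Set.Icc (fun _ => -((2 * L : ℕ) : ℤ)) (fun _ => ((2 * L : ℕ) : ℤ)))
    ⟨fun j => by have := hu j; simp only [Pi.sub_apply]; omega,
      fun j => by have := hu j; simp only [Pi.sub_apply]; omega⟩ (Or.inl (by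
        rintro ⟨h1, h2⟩
        have h1 := h1 i
        have h2 := h2 i
        simp only [Pi.sub_apply] at h1 h2
        omega))
  obtain ⟨hzK, j, hzj⟩ := innerBoundary_Icc hz
  refine ⟨_, fun j => ?_, z, ⟨fun j => abs_le.2 ⟨hzK.1 j, hzK.2 j⟩, j, ?_⟩,
    hjz.mono Set.inter_subset_left⟩
  · have := hu j
    simp only [Pi.sub_apply, abs_le]
    omega
  · rcases hzj with h1 | h1 <;> rw [h1] <;> simp

theorem IsGFF.frequently_crossProb_le (hμ : IsGFF μ) {h : ℝ} (hh : PolyDecay μ h) {ε : ℝ}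
    (hε : 0 < ε) : ∃ᶠ L : ℕ in atTop, crossProb μ h L ≤ ε := by
  obtain ⟨α, hα, hlim⟩ := hh
  have h1 : ∀ᶠ L : ℕ in atTop, crossProb μ h (2 * L) ≤ ε := by
    filter_upwards [hlim.eventually_le_const hε, eventually_ge_atTop 1] with L hL hL1
    refine (hμ.crossProb_two_mul_le h hL1).trans (le_trans ?_ hL)
    exact le_mul_of_one_le_left measureReal_nonneg
      (Real.one_le_rpow (by exact_mod_cast hL1) hα.le)
  exact (tendsto_id.const_mul_atTop' (by norm_num : 0 < 2)).frequently h1.frequently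

theorem card_supBall (L : ℕ) :
    (Finset.Icc (fun _ : Fin d => -(L : ℤ)) (fun _ => (L : ℤ))).card = (2 * L + 1) ^ d := by
  rw [Pi.card_Icc]
  have : (Finset.Icc (-(L : ℤ)) L).card = 2 * L + 1 := by
    rw [Int.card_Icc]
    omega
  simp [this]

/-- Smallness along a subsequence at `h` upgrades to stretched exponential decay above `h`, which
beats the union bound over the starting points in `B(0, L)`. The case `b = 2` is enough, since
`log^6 L ≤ √L` eventually. -/
theorem IsGFF.polyDecay_of_frequently (hμ : IsGFF μ) (hd : 3 ≤ d) {h h' : ℝ} (hh : h < h')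
    {θ₀ : ℝ} (hθ₀ : 0 < θ₀) (hθ₁ : θ₀ < 1)
    (hfreq : ∃ᶠ M : ℕ in atTop, pairCount d * crossProb μ h M ≤ θ₀) : PolyDecay μ h' := by
  have := hμ.isProbabilityMeasure
  obtain ⟨c, r₀, hc, hr₀, hfar⟩ := hμ.farEvent_le_exp_div_log hd (b := 2) (by norm_num) hh hθ₀ hθ₁
    hfreq
  have hlim : Tendsto (fun L : ℕ => 3 ^ d / c ^ (2 * (d + 1)) *
      ((c * √(L : ℝ)) ^ (2 * (d + 1)) * Real.exp (-(c * √(L : ℝ))))) atTop (𝓝 0) := by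
    rw [← mul_zero (3 ^ d / c ^ (2 * (d + 1)))]
    refine Tendsto.const_mul _ ((Real.tendsto_pow_mul_exp_neg_atTop_nhds_zero _).comp ?_)
    exact (Real.tendsto_sqrt_atTop.comp tendsto_natCast_atTop_atTop).const_mul_atTop hc
  have hlog : ∀ᶠ L : ℕ in atTop, Real.log L ^ 12 ≤ L := by
    have := (Real.isLittleO_pow_log_id_atTop (n := 12)).bound one_pos
    filter_upwards [tendsto_natCast_atTop_atTop.eventually this] with L hL
    simpa [abs_of_nonneg] using (le_abs_self _).trans hL
  refine ⟨1, one_pos, squeeze_zero' (Eventually.of_forall fun L => by positivity) ?_ hlim⟩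
  filter_upwards [hlog, eventually_gt_atTop r₀, eventually_gt_atTop 1] with L hLlog hL hL1
  have hL' : (1 : ℝ) < L := by exact_mod_cast hL1
  have hsub : connects h' (supBall d L) (supSphere d (2 * L)) ⊆
      ⋃ u ∈ Finset.Icc (fun _ : Fin d => -(L : ℤ)) (fun _ => (L : ℤ)), farEvent h' u L := by
    rintro φ ⟨u, hu, v, ⟨-, i, hi⟩, hj⟩
    simp only [Set.mem_iUnion]
    refine ⟨u, Finset.mem_Icc.2 ⟨fun j => (abs_le.1 (hu j)).1, fun j => (abs_le.1 (hu j)).2⟩,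
      v, ⟨i, ?_⟩, hj⟩
    have h1 := hu i
    have h2 := abs_sub_abs_le_abs_sub (v i) (u i)
    rw [hi] at h2
    push_cast at h2
    omega
  have hP : μ.real (connects h' (supBall d L) (supSphere d (2 * L))) ≤
      (2 * L + 1) ^ d * Real.exp (-(c * √(L : ℝ))) := by
    refine (measureReal_mono hsub (measure_ne_top _ _)).trans
      ((measureReal_biUnion_finset_le _ _).trans ?_)
    refine (Finset.sum_le_card_nsmul _ _ (Real.exp (-(c * √(L : ℝ)))) fun u _ =>
      (hfar L hL u).trans ?_).trans (le_of_eq ?_)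
    · have hlogpos : 0 < Real.log L := Real.log_pos hL'
      have h6 : Real.log L ^ (3 * 2 : ℝ) = Real.log L ^ 6 := by
        rw [← Real.rpow_natCast]; norm_num
      have h7 : Real.log L ^ 6 ≤ √(L : ℝ) := by
        apply Real.le_sqrt_of_sq_le
        rw [← pow_mul]; exact hLlog
      rw [Real.exp_le_exp, neg_le_neg_iff, h6]
      gcongr
      rw [le_div_iff₀ (by positivity)]
      calc √(L : ℝ) * Real.log L ^ 6 ≤ √(L : ℝ) * √(L : ℝ) := by gcongr
        _ = L := Real.mul_self_sqrt (by positivity)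
    · rw [nsmul_eq_mul, card_supBall]
      push_cast
      ring
  rw [Real.rpow_one]
  calc (L : ℝ) * μ.real (connects h' (supBall d L) (supSphere d (2 * L)))
      ≤ L * ((3 * L) ^ d * Real.exp (-(c * √(L : ℝ)))) := by
        gcongr
        refine hP.trans ?_
        gcongr
        linarith
    _ = 3 ^ d / c ^ (2 * (d + 1)) *
        ((c * √(L : ℝ)) ^ (2 * (d + 1)) * Real.exp (-(c * √(L : ℝ)))) := by
        have : √(L : ℝ) ^ (2 * (d + 1)) = (L : ℝ) ^ (d + 1) := by
          rw [pow_mul, Real.sq_sqrt (by positivity)]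
        rw [mul_pow c, this, mul_pow, pow_succ]
        field_simp

theorem IsGFF.nonneg_of_polyDecay (hμ : IsGFF μ) (hd : 3 ≤ d) {h : ℝ} (hh : PolyDecay μ h) :
    0 ≤ h := by
  by_contra hneg
  obtain ⟨c, hc, hle⟩ := hμ.exists_le_measureReal_connects hd (not_le.1 hneg)
  obtain ⟨α, hα, hlim⟩ := hh
  obtain ⟨L, hL, hL1⟩ := ((hlim.eventually_lt_const hc).and (eventually_ge_atTop 1)).exists
  have h1 : (1 : ℝ) ≤ (L : ℝ) ^ α := Real.one_le_rpow (by exact_mod_cast hL1) hα.le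
  have h2 := hle L
  have h3 := le_mul_of_one_le_left (measureReal_nonneg (μ := μ)
    (s := connects h (supBall d L) (supSphere d (2 * L)))) h1
  linarith

theorem pairCount_pos (hd : 3 ≤ d) : 0 < pairCount d := by
  have : (0 : ℝ) < d := by exact_mod_cast (by omega : 0 < d)
  unfold pairCount
  positivity

theorem IsGFF.frequently_of_polyDecay (hμ : IsGFF μ) (hd : 3 ≤ d) {h : ℝ} (hh : PolyDecay μ h) :
    ∃ᶠ M : ℕ in atTop, pairCount d * crossProb μ h M ≤ 1 / 2 := by
  have hΛ := pairCount_pos hd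
  refine (hμ.frequently_crossProb_le hh (ε := 1 / 2 / pairCount d) (by positivity)).mono
    fun L hL => ?_
  rwa [le_div_iff₀ hΛ, mul_comm] at hL

theorem exists_polyDecay_of_lt {h : ℝ} (hh : hStarStar μ < (h : EReal)) :
    ∃ h₀ < h, PolyDecay μ h₀ := by
  obtain ⟨_, ⟨h₀, hh₀, rfl⟩, hlt⟩ := sInf_lt_iff.1 hh
  exact ⟨h₀, by exact_mod_cast hlt, hh₀⟩

theorem hStarStar_le {h : ℝ} (hh : PolyDecay μ h) : hStarStar μ ≤ h :=
  sInf_le ⟨h, hh, rfl⟩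

theorem euclNorm_sq (x : Fin d → ℤ) : euclNorm x ^ 2 = ((∑ i, x i ^ 2 : ℤ) : ℝ) := by
  simp [euclNorm, EuclideanSpace.norm_sq_eq]

theorem euclNorm_nonneg (x : Fin d → ℤ) : 0 ≤ euclNorm x := norm_nonneg _

/-- The sup norm of a site, attained at some coordinate, is comparable to the Euclidean norm. -/
theorem exists_supNorm (hd : 0 < d) (x : Fin d → ℤ) :
    ∃ r : ℕ, (∃ i, (r : ℤ) = |x i|) ∧ (r : ℝ) ≤ euclNorm x ∧ euclNorm x ≤ d * r := by
  have : Nonempty (Fin d) := ⟨⟨0, hd⟩⟩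
  obtain ⟨i, hi⟩ := Finite.exists_max fun i => (x i).natAbs
  have hsq : ∀ j, (x j : ℝ) ^ 2 = (((x j).natAbs : ℕ) : ℝ) ^ 2 := by
    intro j
    rw [Nat.cast_natAbs]
    push_cast
    rw [sq_abs]
  have hE := euclNorm_sq x
  push_cast at hE
  refine ⟨(x i).natAbs, ⟨i, by simp⟩, ?_, ?_⟩
  · refine (sq_le_sq₀ (by positivity) (euclNorm_nonneg x)).1 ?_
    rw [hE, ← hsq]
    exact Finset.single_le_sum (f := fun i => (x i : ℝ) ^ 2) (fun i _ => sq_nonneg _)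
      (Finset.mem_univ i)
  · refine (sq_le_sq₀ (euclNorm_nonneg x) (by positivity)).1 ?_
    rw [hE]
    calc ∑ j, (x j : ℝ) ^ 2 ≤ ∑ _j : Fin d, (((x i).natAbs : ℕ) : ℝ) ^ 2 := by
          refine Finset.sum_le_sum fun j _ => ?_
          rw [hsq]
          have := hi j
          gcongr
      _ = d * (((x i).natAbs : ℕ) : ℝ) ^ 2 := by simp
      _ ≤ (d : ℝ) ^ 2 * (((x i).natAbs : ℕ) : ℝ) ^ 2 := by
          gcongr
          have : (1 : ℝ) ≤ d := by exact_mod_cast hd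
          nlinarith
      _ = _ := by ring

theorem connects_subset_farEvent {h : ℝ} {x : Fin d → ℤ} {r : ℕ} (hr : ∃ i, (r : ℤ) = |x i|) :
    connects h {0} {x} ⊆ farEvent h 0 r := by
  rintro φ ⟨u, hu, v, hv, hw⟩
  obtain ⟨i, hi⟩ := hr
  cases hu
  cases hv
  exact ⟨x, ⟨i, by simp [hi]⟩, hw⟩

theorem IsGFF.connects_le_exp (hμ : IsGFF μ) (hd : 4 ≤ d) {h : ℝ} (hh : hStarStar μ < (h : EReal)) :
    ∃ γ₁ γ₂ : ℝ, 0 < γ₁ ∧ 0 < γ₂ ∧ ∀ x : Fin d → ℤ,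
      μ.real (connects h {0} {x}) ≤ γ₁ * Real.exp (-γ₂ * euclNorm x) := by
  have := hμ.isProbabilityMeasure
  obtain ⟨h₀, hlt, hpoly⟩ := exists_polyDecay_of_lt hh
  obtain ⟨c, r₀, hc, hfar⟩ := hμ.farEvent_le_exp hd hlt (by norm_num) (by norm_num)
    (hμ.frequently_of_polyDecay (by omega) hpoly)
  have hd' : (0 : ℝ) < d := by exact_mod_cast (by omega : 0 < d)
  -- The prefactor makes the bound trivial for the sites with sup norm at most `r₀`.
  refine ⟨Real.exp (c * r₀), c / d, Real.exp_pos _, by positivity, fun x => ?_⟩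
  obtain ⟨r, hr, -, hr2⟩ := exists_supNorm (by omega) x
  have hle : c / d * euclNorm x ≤ c * r := by
    calc c / d * euclNorm x ≤ c / d * (d * r) := by gcongr
      _ = c * r := by field_simp
  rw [← Real.exp_add]
  rcases le_or_gt r r₀ with hrr | hrr
  · refine measureReal_le_one.trans (Real.one_le_exp ?_)
    have : c * (r : ℝ) ≤ c * r₀ := by gcongr
    linarith
  · refine (measureReal_mono (connects_subset_farEvent hr)).trans ((hfar r hrr 0).trans ?_)
    rw [Real.exp_le_exp]
    have : 0 ≤ c * (r₀ : ℝ) := by positivity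
    linarith

theorem IsGFF.connects_le_exp_div_log (hμ : IsGFF μ) (hd : 3 ≤ d) {h : ℝ}
    (hh : hStarStar μ < (h : EReal)) {b : ℝ} (hb : 1 < b) :
    ∃ γ₁ γ₂ : ℝ, 0 < γ₁ ∧ 0 < γ₂ ∧ ∀ x : Fin d → ℤ, 1 < euclNorm x →
      μ.real (connects h {0} {x}) ≤
        γ₁ * Real.exp (-γ₂ * (euclNorm x / Real.log (euclNorm x) ^ (3 * b))) := by
  have := hμ.isProbabilityMeasure
  obtain ⟨h₀, hlt, hpoly⟩ := exists_polyDecay_of_lt hh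
  obtain ⟨c, r₀, hc, hr₀, hfar⟩ := hμ.farEvent_le_exp_div_log hd hb hlt (by norm_num) (by norm_num)
    (hμ.frequently_of_polyDecay hd hpoly)
  have hd' : (0 : ℝ) < d := by exact_mod_cast (by omega : 0 < d)
  -- The squared norm is an integer above 1, so `log ‖x‖ ≥ ℓ`. Hence `D` bounds the exponent ratio
  -- for sites of sup norm at most `r₀`.
  set ℓ := Real.log 2 / 2 with hℓ
  have hℓ0 : 0 < ℓ := by have := Real.log_pos (one_lt_two (α := ℝ)); positivity
  set D := d * r₀ / ℓ ^ (3 * b) with hD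
  have hD0 : 0 ≤ D := by positivity
  refine ⟨Real.exp (c / d * D), c / d, Real.exp_pos _, by positivity, fun x hx => ?_⟩
  obtain ⟨r, hr, hr1, hr2⟩ := exists_supNorm (by omega) x
  have hlogx : ℓ ≤ Real.log (euclNorm x) := by
    have h1 : (2 : ℝ) ≤ euclNorm x ^ 2 := by
      have h2 : (1 : ℝ) < euclNorm x ^ 2 := by nlinarith
      rw [euclNorm_sq] at h2 ⊢
      have h3 : 1 < ∑ i, x i ^ 2 := by exact_mod_cast h2
      exact_mod_cast h3
    have h2 := Real.log_le_log (by norm_num) h1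
    rw [Real.log_pow] at h2
    push_cast at h2
    linarith
  rw [← Real.exp_add]
  rcases le_or_gt r r₀ with hrr | hrr
  · refine measureReal_le_one.trans (Real.one_le_exp ?_)
    have : euclNorm x / Real.log (euclNorm x) ^ (3 * b) ≤ D := by
      rw [hD]
      gcongr
      exact hr2.trans (by gcongr)
    have := mul_le_mul_of_nonneg_left this (by positivity : 0 ≤ c / d)
    linarith
  · refine (measureReal_mono (connects_subset_farEvent hr)).trans ((hfar r hrr 0).trans ?_)
    rw [Real.exp_le_exp]
    have hr' : (1 : ℝ) < r := by exact_mod_cast (by omega : 1 < r)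
    have hlogr : 0 < Real.log r := Real.log_pos hr'
    have h1 : c / d * (euclNorm x / Real.log (euclNorm x) ^ (3 * b)) ≤
        c * (r / Real.log r ^ (3 * b)) := by
      calc c / d * (euclNorm x / Real.log (euclNorm x) ^ (3 * b))
          ≤ c / d * (d * r / Real.log r ^ (3 * b)) := by gcongr
        _ = c * (r / Real.log r ^ (3 * b)) := by field_simp
    have h2 : 0 ≤ c / d * D := by positivity
    linarith

/-- A liminf below `1 / pairCount d` at `h` starts the renormalization and gives polynomial decay at
every `h' > h`. Conversely, polynomial decay at `h` makes the crossing probability small infinitely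
often at every `h' > h`, and such `h'` are positive by `IsGFF.nonneg_of_polyDecay`. -/
theorem IsGFF.hStarStar_eq (hμ : IsGFF μ) (hd : 3 ≤ d) :
    hStarStar μ = sInf (Real.toEReal '' {h : ℝ | 0 < h ∧
      liminf (fun L : ℕ => μ.real (connects h (box d 0 L)
        (innerBoundary (box d (-L) (2 * L))))) atTop < 7 / (2 * d * 21 ^ d)}) := by
  have := hμ.isProbabilityMeasure
  have hΛ := pairCount_pos hd
  have hd' : (0 : ℝ) < d := by exact_mod_cast (by omega : 0 < d)
  have hcrit : (7 : ℝ) / (2 * d * 21 ^ d) = 1 / pairCount d := by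
    rw [pairCount_eq (by omega), one_div_div]
  simp only [connects_box_eq, hcrit]
  change _ = sInf (Real.toEReal '' {h : ℝ | 0 < h ∧
    liminf (fun L : ℕ => crossProb μ h L) atTop < 1 / pairCount d})
  have hbdd : ∀ h, IsBoundedUnder (· ≥ ·) atTop fun L : ℕ => crossProb μ h L := fun h =>
    isBoundedUnder_of ⟨0, fun L => measureReal_nonneg⟩
  have hcob : ∀ h, IsCoboundedUnder (· ≥ ·) atTop fun L : ℕ => crossProb μ h L := fun h =>
    (isBoundedUnder_of ⟨1, fun L => measureReal_le_one⟩ :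
      IsBoundedUnder (· ≤ ·) atTop fun L : ℕ => crossProb μ h L).isCoboundedUnder_ge
  refine le_antisymm (le_sInf ?_) (le_sInf ?_)
  · rintro _ ⟨h, ⟨-, hlim⟩, rfl⟩
    obtain ⟨c, hc1, hc2⟩ := exists_between hlim
    have hfreq := frequently_lt_of_liminf_lt (hcob h) hc1
    obtain ⟨L, hL⟩ := hfreq.exists
    have hc0 : 0 < c := lt_of_le_of_lt measureReal_nonneg hL
    rw [lt_div_iff₀ hΛ] at hc2
    refine (EReal.le_of_forall_lt_iff_le).1 fun h' hh' => hStarStar_le ?_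
    refine hμ.polyDecay_of_frequently hd (by exact_mod_cast hh') (θ₀ := c * pairCount d)
      (by positivity) hc2 (hfreq.mono fun L hL => ?_)
    rw [mul_comm]
    gcongr
  · rintro _ ⟨h, hh, rfl⟩
    have hh : PolyDecay μ h := hh
    have h0 := hμ.nonneg_of_polyDecay hd hh
    refine (EReal.le_of_forall_lt_iff_le).1 fun h' hh' => sInf_le ⟨h', ⟨?_, ?_⟩, rfl⟩
    · have : h < h' := by exact_mod_cast hh'
      linarith
    · have hlt : h < h' := by exact_mod_cast hh'
      refine lt_of_le_of_lt (liminf_le_of_frequently_le ((hμ.frequently_crossProb_le hh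
        (ε := 1 / (2 * pairCount d)) (by positivity)).mono fun L hL =>
          (hμ.crossProb_anti hlt.le L).trans hL) (hbdd h')) ?_
      apply one_div_lt_one_div_of_lt hΛ
      linarith

end Decay

end GFF

end

theorem theorem2 (d : ℕ) (hd : 3 ≤ d) (μ : Measure ((Fin d → ℤ) → ℝ)) (hμ : GFF.IsGFF μ) :
    (4 ≤ d → ∀ h : ℝ, GFF.hStarStar μ < (h : EReal) →
      ∃ γ₁ γ₂ : ℝ, 0 < γ₁ ∧ 0 < γ₂ ∧ ∀ x : Fin d → ℤ,
        μ.real (GFF.connects h {0} {x}) ≤ γ₁ * Real.exp (-γ₂ * GFF.euclNorm x)) ∧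
    (d = 3 → ∀ h : ℝ, GFF.hStarStar μ < (h : EReal) → ∀ b : ℝ, 1 < b →
      ∃ γ₁ γ₂ : ℝ, 0 < γ₁ ∧ 0 < γ₂ ∧ ∀ x : Fin d → ℤ, 1 < GFF.euclNorm x →
        μ.real (GFF.connects h {0} {x}) ≤
          γ₁ * Real.exp (-γ₂ * (GFF.euclNorm x / Real.log (GFF.euclNorm x) ^ (3 * b)))) ∧
    GFF.hStarStar μ = sInf (Real.toEReal '' {h : ℝ | 0 < h ∧
      liminf (fun L : ℕ => μ.real (GFF.connects h (GFF.box d 0 L)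
        (GFF.innerBoundary (GFF.box d (-L) (2 * L))))) atTop < 7 / (2 * d * 21 ^ d)}) :=
  ⟨fun h4 _ hh => hμ.connects_le_exp h4 hh,
    fun _ _ hh _ hb => hμ.connects_le_exp_div_log hd hh hb, hμ.hStarStar_eq hd⟩
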